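/- **Setting.** There are $n$ pages with weights $w(p)\ge 0$ and a cache, initially empty, that holds at most $k$ pages. In paging with time windows and penalties, a finite sequence of requests is given; a request $I$ consists of a page $\mathrm{page}(I)$, an integer interval $[s(I),e(I)]\subseteq\{0,\dots,T\}$ and a penalty $\ell(I)\in[0,\infty]$; timesteps are normalised so that at most one request ends at any time (if there is one at time $t$, it is called $I_t$). At every time a schedule performs finitely many loads (free) and evictions (evicting $p$ costs $w(p)$), never holding more than $k$ pages. A request is served if its page is in the cache at some moment of its interval; the penalty of each unserved request is paid. In paging with time windows there are no penalties and all requests have to be served. Online, a request (with page, deadline, penalty) is revealed at its start time. The *hitting set program* (IPp) has variables $x_{p,t},y_I\in\{0,1\}$, the objective $\sum_{p,t} w(p)x_{p,t}+\sum_I \ell(I)y_I$, and, for every time $t$, the constraints $$\sum_{I\in\mathcal C}\Big(y_I+\sum_{t'=s(I)}^{\max(t,e(I))}x_{\mathrm{page}(I),t'}\Big)\ge 1$$ for every set $\mathcal C$ of $k+1$ requests for distinct pages with $s(I)\le t$, and, if some request $I_t$ ends at $t$, $$\sum_{I\in\mathcal C}\Big(y_I+\sum_{t'=\min(s(I_t),s(I))}^{t}x_{\mathrm{page}(I),t'}\Big)\ge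 1-y_{I_t}$$ for every set $\mathcal C$ of $k$ requests for distinct pages other than $\mathrm{page}(I_t)$ with $e(I)\le t$. The program (IP) is the same with all $y_I=0$. An *online integral solution* is a sequence of 0/1 assignments, one for each time $t$, the $t$-th one satisfying the constraints for the times up to $t$ and with $y_I=1$ only for requests $I$ revealed by time $t$, that is * *monotone*: variables set to $1$ stay $1$; * *past-preserving*: at time $t$, only variables $x_{p,t'}$ with $t'\ge t$ and $y_I$ with $e(I)\ge t$ are newly set to $1$; * *sparse*: at time $t$, for each page $p$ there is at most one $t'>t$ with $x_{p,t'}=1$, and then $t'$ lies in every request interval for $p$ that contains $t$ and whose request has $y_I=0$. Its cost is the cost of the final assignment. It is *$\alpha$-competitive with additive constant $b$* if this cost is at most $\alpha$ times the cost of any feasible solution of the program, plus $b$. **Theorem.** There is an absolute constant $C$ such that for all $n,k,w$ there is an online algorithm which converts every online integral solution of (IPp), for every request sequence, into a valid schedule. At time $t$ the algorithm uses only what it has seen at times $\le t$, and what it sees at a time $t'$ is: the requests revealed by time $t'$, the current variables $y_I$ and $x_{p,t''}$ with $t''\le t'$, and the set of pages $p$ with $x_{p,t''}=1$ for some $t''>t'$.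 The schedule serves every request $I$ with $y_I=0$ in the final assignment, and 1. its cost (evictions and penalties) is at most $C(1+\log n)$ times the cost of the online integral solution; 2. if the online integral solution is $\alpha$-competitive with additive constant $b$ for (IPp), then the cost of the schedule is at most $C(1+\log n)\big(\alpha\,(\mathrm{cost}(S)+\sum_p w(p))+b\big)$ for every valid schedule $S$ for the same requests; that is, the schedule is $O(\alpha\log n)$-competitive, up to an additive term that does not depend on the request sequence. In particular, for an online integral solution with all $y_I=0$, the schedule serves all requests, its eviction cost is at most $C(1+\log n)$ times the cost of the solution, and if the solution is $\alpha$-competitive with additive constant $b$ for (IP), the eviction cost is at most $C(1+\log n)\big(\alpha\,(\mathrm{evictions}(S)+\sum_p w(p))+b\big)$ for every valid schedule $S$ that serves all requests, where $\mathrm{evictions}(S)$ is the eviction cost of $S$. -/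

import Mathlib

open scoped NNReal ENNReal

noncomputable section

namespace PagingTW

/-! ### Instances of weighted paging with time windows and penalties -/

/-- A request: `page` has to be in the cache at some time in `{start, …, deadline}`, or else the
penalty is paid. The value `∞` is allowed as a penalty. -/
structure Request (n : ℕ) where
  page : Fin n
  start : ℕ
  deadline : ℕ
  penalty : ℝ≥0∞

instance (n : ℕ) : DecidableEq (Request n) := Classical.decEq _

/-- A finite request sequence over `n` pages, on the times `0, …, horizon`. Timesteps are
normalised so that no two requests have the same deadline. -/
structure Instance (n : ℕ) where
  horizon : ℕ
  requests : Finset (Request n)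
  start_le_deadline : ∀ r ∈ requests, r.start ≤ r.deadline
  deadline_le_horizon : ∀ r ∈ requests, r.deadline ≤ horizon
  deadline_injOn : Set.InjOn Request.deadline (requests : Set (Request n))

/-! ### Cache schedules -/

/-- An elementary operation on the cache. -/
inductive Op (n : ℕ) where
  | load (p : Fin n)
  | evict (p : Fin n)

/-- The effect of an operation on the content of the cache. -/
def Op.apply {n : ℕ} : Op n → Finset (Fin n) → Finset (Fin n)
  | .load p, c => insert p c
  | .evict p, c => c.erase p

/-- Loading is free, evicting `p` costs `w p`. -/
def Op.cost {n : ℕ} (w : Fin n → ℝ≥0) : Op n → ℝ≥0∞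
  | .load _ => 0
  | .evict p => (w p : ℝ≥0∞)

/-- A schedule performs a finite sequence of operations at every time. -/
abbrev Schedule (n : ℕ) := ℕ → List (Op n)

/-- The content of the cache at the beginning of time `t`. The cache is initially empty. -/
def Schedule.cacheAt {n : ℕ} (S : Schedule n) : ℕ → Finset (Fin n)
  | 0 => ∅
  | t + 1 => (S t).foldl (fun c o => o.apply c) (S.cacheAt t)

/-- All cache contents that occur during time `t`, in order: the one at the beginning of time `t`,
and the one after each of the operations of time `t`. -/
def Schedule.trace {n : ℕ} (S : Schedule n) (t : ℕ) : List (Finset (Fin n)) :=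
  (S t).scanl (fun c o => o.apply c) (S.cacheAt t)

/-- The cache never holds more than `k` pages. -/
def Schedule.Valid {n : ℕ} (S : Schedule n) (σ : Instance n) (k : ℕ) : Prop :=
  ∀ t ≤ σ.horizon, ∀ c ∈ S.trace t, c.card ≤ k

/-- The requested page is in the cache at some moment of the request interval. -/
def Schedule.Serves {n : ℕ} (S : Schedule n) (r : Request n) : Prop :=
  ∃ t, r.start ≤ t ∧ t ≤ r.deadline ∧ ∃ c ∈ S.trace t, r.page ∈ c

/-- Total weight of all evictions. -/
def Schedule.evictionCost {n : ℕ} (S : Schedule n) (σ : Instance n) (w : Fin n → ℝ≥0) : ℝ≥0∞ :=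
  ∑ t ∈ Finset.range (σ.horizon + 1), ((S t).map (Op.cost w)).sum

open Classical in
/-- Total weight of all evictions, plus the penalties of all requests that are not served. -/
def Schedule.cost {n : ℕ} (S : Schedule n) (σ : Instance n) (w : Fin n → ℝ≥0) : ℝ≥0∞ :=
  S.evictionCost σ w + ∑ r ∈ σ.requests with ¬ S.Serves r, r.penalty

/-! ### The hitting set integer program -/

/-- A 0/1 assignment to the variables `x p t` and `y r`, given by its characteristic sets: the
stars `(p, t)` with `x p t = 1`, and the requests with `y r = 1`, whose penalty is paid. -/
structure IPSolution (n : ℕ) where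
  stars : Finset (Fin n × ℕ)
  penalized : Finset (Request n)

/-- The variable `x p t`. -/
def IPSolution.x {n : ℕ} (A : IPSolution n) (p : Fin n) (t : ℕ) : ℕ :=
  if (p, t) ∈ A.stars then 1 else 0

/-- The variable `y r`. -/
def IPSolution.y {n : ℕ} (A : IPSolution n) (r : Request n) : ℕ :=
  if r ∈ A.penalized then 1 else 0

/-- The objective function. -/
def IPSolution.cost {n : ℕ} (A : IPSolution n) (w : Fin n → ℝ≥0) : ℝ≥0∞ :=
  ∑ a ∈ A.stars, (w a.1 : ℝ≥0∞) + ∑ r ∈ A.penalized, r.penalty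

/-- The right extension at time `t` of a request that starts at time `t` or earlier. -/
def rightExt {n : ℕ} (r : Request n) (t : ℕ) : Finset ℕ :=
  Finset.Icc r.start (max t r.deadline)

/-- The double extension of a request `r` at the deadline of the critical request `c`, when the
deadline of `r` is not later than that of `c`. -/
def doubleExt {n : ℕ} (c r : Request n) : Finset ℕ :=
  Finset.Icc (min c.start r.start) c.deadline

/-- The right extension constraints for time `t`. -/
def RightConstraints {n : ℕ} (σ : Instance n) (k : ℕ) (A : IPSolution n) (t : ℕ) : Prop :=
  ∀ C ⊆ σ.requests, C.card = k + 1 → Set.InjOn Request.page (C : Set (Request n)) →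
    (∀ r ∈ C, r.start ≤ t) →
    1 ≤ ∑ r ∈ C, (A.y r + ∑ t' ∈ rightExt r t, A.x r.page t')

/-- The double extension constraints for time `t`, with `c` the request that ends at time `t`
(there is at most one). The term `A.y c` is on the right to avoid a subtraction. -/
def DoubleConstraints {n : ℕ} (σ : Instance n) (k : ℕ) (A : IPSolution n) (t : ℕ) : Prop :=
  ∀ c ∈ σ.requests, c.deadline = t →
    ∀ C ⊆ σ.requests, C.card = k → Set.InjOn Request.page (C : Set (Request n)) →
      (∀ r ∈ C, r.page ≠ c.page ∧ r.deadline ≤ t) →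
      1 ≤ (∑ r ∈ C, (A.y r + ∑ t' ∈ doubleExt c r, A.x r.page t')) + A.y c

/-- `A` satisfies all the constraints for the times `0, …, T`. -/
def IPSolution.FeasibleUpTo {n : ℕ} (A : IPSolution n) (σ : Instance n) (k T : ℕ) : Prop :=
  ∀ t ≤ T, RightConstraints σ k A t ∧ DoubleConstraints σ k A t

/-- `A` is a feasible solution of the integer program. -/
def IPSolution.Feasible {n : ℕ} (A : IPSolution n) (σ : Instance n) (k : ℕ) : Prop :=
  A.penalized ⊆ σ.requests ∧ A.FeasibleUpTo σ k σ.horizon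

/-! ### Online solutions of the integer program -/

/-- The requests that are known at time `t`; each request is revealed, with its page, deadline
and penalty, at its start time. -/
def Instance.revealed {n : ℕ} (σ : Instance n) (t : ℕ) : Finset (Request n) :=
  {r ∈ σ.requests | r.start ≤ t}

/-- `A t` is the solution that is held at time `t`, an integral solution that satisfies the
constraints for time `t` and earlier; the sequence is monotone, past-preserving and sparse. -/
structure IsOnlineSolution {n : ℕ} (σ : Instance n) (k : ℕ) (A : ℕ → IPSolution n) : Prop where
  penalized_revealed : ∀ t ≤ σ.horizon, (A t).penalized ⊆ σ.revealed t
  feasible : ∀ t ≤ σ.horizon, (A t).FeasibleUpTo σ k t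
  /-- Monotonicity: a variable that has been set to `1` remains `1`. -/
  monotone : ∀ t < σ.horizon,
    (A t).stars ⊆ (A (t + 1)).stars ∧ (A t).penalized ⊆ (A (t + 1)).penalized
  /-- Past-preservation: at time `t + 1`, only stars for the times from `t + 1` on are added,
  and the penalty is accepted only for requests whose deadline has not passed. -/
  past_stars : ∀ t < σ.horizon, ∀ a ∈ (A (t + 1)).stars, a ∉ (A t).stars → t + 1 ≤ a.2
  past_penalized : ∀ t < σ.horizon, ∀ r ∈ (A (t + 1)).penalized, r ∉ (A t).penalized →
    t + 1 ≤ r.deadline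
  /-- Sparsity: at time `t` there is at most one star per page after time `t`, … -/
  sparse_unique : ∀ t ≤ σ.horizon, ∀ p t₁ t₂, t < t₁ → t < t₂ →
    (p, t₁) ∈ (A t).stars → (p, t₂) ∈ (A t).stars → t₁ = t₂
  /-- … and such a star hits all intervals that contain `t` of requests for this page, except
  those whose penalty is paid, which need not be satisfied. -/
  sparse_hits : ∀ t ≤ σ.horizon, ∀ p t', t < t' → (p, t') ∈ (A t).stars →
    ∀ r ∈ σ.requests, r.page = p → r.start ≤ t → t ≤ r.deadline → r ∉ (A t).penalized →
      t' ∈ Finset.Icc r.start r.deadline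

/-- The sequence of solutions is `α`-competitive on `σ`, with additive constant `b`, for the
integer program with penalties. -/
def IPCompetitive {n : ℕ} (σ : Instance n) (k : ℕ) (w : Fin n → ℝ≥0) (A : ℕ → IPSolution n)
    (α b : ℝ≥0) : Prop :=
  ∀ B : IPSolution n, B.Feasible σ k → (A σ.horizon).cost w ≤ α * B.cost w + b

/-- The same for the integer program without penalties, where all variables `y` are `0`. -/
def IPCompetitiveNoPenalty {n : ℕ} (σ : Instance n) (k : ℕ) (w : Fin n → ℝ≥0)
    (A : ℕ → IPSolution n) (α b : ℝ≥0) : Prop :=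
  ∀ B : IPSolution n, B.penalized = ∅ → B.Feasible σ k →
    (A σ.horizon).cost w ≤ α * B.cost w + b

/-! ### Online conversion algorithms -/

/-- What is seen at one time `t`: the requests that have been revealed, the stars of the current
solution at times up to `t`, the pages (only) of its stars after time `t`, and the requests whose
penalty it pays. -/
structure Observation (n : ℕ) where
  requests : Finset (Request n)
  stars : Finset (Fin n × ℕ)
  pending : Finset (Fin n)
  penalized : Finset (Request n)

/-- The observation at time `t`. -/
def observe {n : ℕ} (σ : Instance n) (A : ℕ → IPSolution n) (t : ℕ) : Observation n where
  requests := σ.revealed t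
  stars := {a ∈ (A t).stars | a.2 ≤ t}
  pending := {a ∈ (A t).stars | t < a.2}.image Prod.fst
  penalized := (A t).penalized

/-- An online algorithm: the operations at time `t` are a function of the list of the observations
at the times `0, …, t`. -/
abbrev OnlineAlgorithm (n : ℕ) := List (Observation n) → List (Op n)

/-- The schedule that the algorithm produces. -/
def OnlineAlgorithm.run {n : ℕ} (alg : OnlineAlgorithm n) (σ : Instance n)
    (A : ℕ → IPSolution n) : Schedule n :=
  fun t => alg ((List.range (t + 1)).map (observe σ A))

end PagingTW

end

/-!
The conversion algorithm keeps in the cache exactly the pages that are *required*: `p` is required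
at time `t` if it has a request that has ended, is not penalized, and has had no star since its
start. By the right extension constraints there are at most `k` such pages (`card_requiredAt_le`),
and a page that is no longer required has a star at this very time, which pays for its eviction
(`sum_removed_le`).

Only a *critical* request `c` needs attention, one that ends now, has a star, and has not been
served. If there is a free place, its page is loaded and evicted. Otherwise, the double extension
constraints for `c` provide a required page `q` with a star since the start of `c`
(`exists_canMakeRoom`). It is removed from the cache for a moment. Let `u` be its weight, rounded
down to a power of two. While `q` is away, the algorithm visits not only the page of `c`, but also
the pages of other outstanding requests in the order of their deadlines, ignoring pages of weight at
least `2 * u`, until a weight of `u` is reached (`batch`). All this costs `O(u)` plus the weight of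
the page of `c`.

The page of `c` pays with a past star, which cannot happen again for this star, since requests that
are still waiting later on start after the visit (`sum_paid_le`). If this page has weight `2 * u` or
more, it also pays for `u`. Otherwise, let `t₁` be the last earlier time at which a page of the
weight class `u` made room. If `c` started after `t₁`, or if there is no such `t₁`, then the star of
`q` has not paid for this class before, and it pays. If `c` was waiting already, then it was passed
over at time `t₁`, so a weight of at least `u` in pages with earlier deadlines was visited at that
time (`exists_subset_batch`). As the cache was full, the right extension constraints say that all
their requests have stars (`exists_star_of_full`). These pay for `u`: stars until `t₁` again pay
only once, and stars between `t₁` and now pay once for each class `u`. Pages of weight less than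
`u / (2 * n)` do not matter for the weight of the batch, and pages of weight `2 * u` or more are not in
it, so only `O(log n)` classes are relevant for a star. The charging argument is `sum_unit_le`, and
the total is bounded in `sum_serviceCost_le`.

For competitiveness, a schedule is turned into a feasible solution of the program with a star
`(p, t)` whenever `p` enters or leaves the cache at time `t` (`Schedule.toIP_feasible`). Every page is
loaded at most once more than it is evicted, so the cost is at most twice the cost of the schedule,
plus the weights of all pages (`Schedule.toIP_cost_le`).
-/

namespace PagingTW

/-! ### Every schedule yields a feasible solution of the program -/

/-- The number of evictions of `p` in a list of operations. -/
def evictCount {n : ℕ} (p : Fin n) : List (Op n) → ℕ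
  | [] => 0
  | .load _ :: l => evictCount p l
  | .evict q :: l => (if q = p then 1 else 0) + evictCount p l

theorem sum_map_cost {n : ℕ} (w : Fin n → ℝ≥0) (l : List (Op n)) :
    (l.map (Op.cost w)).sum = ∑ p, (w p : ℝ≥0∞) * (evictCount p l : ℝ≥0∞) := by
  induction l with
  | nil => simp [evictCount]
  | cons o l ih =>
    cases o with
    | load q => simp [evictCount, Op.cost, ih]
    | evict q =>
      simp [evictCount, Op.cost, ih, mul_add, Finset.sum_add_distrib]

/-- The potential argument behind the factor `2`, with potential `1` while `p` is in the cache: an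
eviction pays for the change that it makes and for the one made by the load before it. -/
theorem change_le_evictCount {n : ℕ} (p : Fin n) (l : List (Op n)) (c : Finset (Fin n)) :
    (if ∃ d ∈ l.scanl (fun c o => o.apply c) c, ¬ (p ∈ d ↔ p ∈ c) then 1 else 0)
        + (if p ∈ c then 1 else 0)
      ≤ 2 * evictCount p l + (if p ∈ l.foldl (fun c o => o.apply c) c then 1 else 0) := by
  by_cases h0 : evictCount p l = 0
  · -- without evictions, `p` stays once it is there
    have key : ∀ (l : List (Op n)) (c : Finset (Fin n)), evictCount p l = 0 →
        ∀ d ∈ l.scanl (fun c o => o.apply c) c,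
          (p ∈ c → p ∈ d) ∧ (p ∈ d → p ∈ l.foldl (fun c o => o.apply c) c) := by
      intro l
      induction l with
      | nil => intro c _ d hd; simp at hd; subst hd; simp
      | cons o l ih =>
        intro c h d hd
        have hl : evictCount p l = 0 := by
          cases o <;> simp [evictCount] at h <;> simp [h]
        have hstep : p ∈ c → p ∈ o.apply c := by
          cases o with
          | load q => intro hp; simp [Op.apply, hp]
          | evict q =>
            intro hp
            simp [evictCount] at h
            simp [Op.apply, hp]
            exact fun e => h.1 e.symm
        rw [List.scanl_cons, List.mem_cons] at hd
        have hfirst := ih (o.apply c) hl (o.apply c) (by cases l <;> simp [List.scanl_cons])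
        rcases hd with rfl | hd
        · exact ⟨id, fun hp => hfirst.2 (hstep hp)⟩
        · exact ⟨fun hp => (ih _ hl d hd).1 (hstep hp), (ih _ hl d hd).2⟩
    have hk := key l c h0
    rw [h0]
    by_cases hc : p ∈ c
    · have h1 : ¬ ∃ d ∈ l.scanl (fun c o => o.apply c) c, ¬ (p ∈ d ↔ p ∈ c) := by
        rintro ⟨d, hd, h⟩
        exact h ⟨fun _ => hc, (hk d hd).1⟩
      have h2 : p ∈ l.foldl (fun c o => o.apply c) c :=
        (hk c (by cases l <;> simp [List.scanl_cons])).2 hc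
      rw [if_neg h1, if_pos hc, if_pos h2]
    · rw [if_neg hc]
      split_ifs with h1 h2
      · simp
      · obtain ⟨d, hd, h⟩ := h1
        exact absurd ((hk d hd).2 (by tauto)) h2
      · simp
      · simp
  · split_ifs <;> omega

namespace Schedule

variable {n : ℕ}

theorem foldl_mem_scanl {α β : Type*} (f : β → α → β) (b : β) (l : List α) :
    l.foldl f b ∈ l.scanl f b := by
  induction l generalizing b with
  | nil => simp
  | cons a l ih => rw [List.scanl_cons, List.foldl_cons]; exact List.mem_cons_of_mem _ (ih _)

theorem cacheAt_succ_mem_trace (S : Schedule n) (t : ℕ) : S.cacheAt (t + 1) ∈ S.trace t :=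
  foldl_mem_scanl _ _ _

/-- The presence of `p` in the cache changes during time `t`. -/
def Changes (S : Schedule n) (p : Fin n) (t : ℕ) : Prop :=
  ∃ d ∈ S.trace t, ¬ (p ∈ d ↔ p ∈ S.cacheAt t)

/-- If `p` is in one of the caches `c` and `d` but not in the other, its presence changes in the
meantime. -/
theorem exists_changes (S : Schedule n) (p : Fin n) {a b : ℕ} {c d : Finset (Fin n)}
    (hc : c ∈ S.trace a) (hd : d ∈ S.trace b) (hcd : ¬ (p ∈ c ↔ p ∈ d)) :
    ∃ t, min a b ≤ t ∧ t ≤ max a b ∧ S.Changes p t := by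
  by_contra! H
  have key : ∀ j, min a b + j ≤ max a b →
      (p ∈ S.cacheAt (min a b + j) ↔ p ∈ S.cacheAt (min a b)) := by
    intro j
    induction j with
    | zero => simp
    | succ j ih =>
      intro hj
      have h1 := H (min a b + j) (by omega) (by omega)
      unfold Changes at h1
      push Not at h1
      rw [← ih (by omega), ← add_assoc]
      exact h1 _ (S.cacheAt_succ_mem_trace _)
  have key2 : ∀ t, min a b ≤ t → t ≤ max a b → ∀ e ∈ S.trace t,
      (p ∈ e ↔ p ∈ S.cacheAt (min a b)) := by
    intro t h1 h2 e he
    have h3 := H t h1 h2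
    unfold Changes at h3
    push Not at h3
    have h4 := key (t - min a b) (by omega)
    rw [show min a b + (t - min a b) = t by omega] at h4
    exact (h3 e he).trans h4
  exact hcd ((key2 a (by omega) (by omega) c hc).trans (key2 b (by omega) (by omega) d hd).symm)

open Classical in
/-- The solution with a star `(p, t)` whenever the presence of `p` changes during time `t`, and
which pays the penalties of the requests that the schedule does not serve. -/
noncomputable def toIP (S : Schedule n) (σ : Instance n) : IPSolution n where
  stars := {a ∈ Finset.univ ×ˢ Finset.range (σ.horizon + 1) | S.Changes a.1 a.2}
  penalized := {r ∈ σ.requests | ¬ S.Serves r}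

theorem one_le_sum_x {A : IPSolution n} {p : Fin n} {t : ℕ} {I : Finset ℕ} (ht : t ∈ I)
    (h : (p, t) ∈ A.stars) : 1 ≤ ∑ t' ∈ I, A.x p t' := by
  have : A.x p t = 1 := by simp [IPSolution.x, h]
  rw [← this]
  exact Finset.single_le_sum (f := fun t' => A.x p t') (fun _ _ => Nat.zero_le _) ht

theorem toIP_feasible (S : Schedule n) (σ : Instance n) (k : ℕ) (hS : S.Valid σ k) :
    (S.toIP σ).Feasible σ k := by
  classical
  refine ⟨Finset.filter_subset _ _, fun t ht => ⟨?_, ?_⟩⟩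
  · intro C hC hcard hinj hstart
    have h1 : ¬ C.image Request.page ⊆ S.cacheAt (t + 1) := by
      intro hsub
      have h2 := Finset.card_le_card hsub
      rw [Finset.card_image_of_injOn hinj, hcard] at h2
      have := hS t ht _ (S.cacheAt_succ_mem_trace t)
      omega
    obtain ⟨p, hp, hpn⟩ := Finset.not_subset.1 h1
    obtain ⟨r, hr, rfl⟩ := Finset.mem_image.1 hp
    refine le_trans ?_ (Finset.single_le_sum (f := fun r => (S.toIP σ).y r +
      ∑ t' ∈ rightExt r t, (S.toIP σ).x r.page t') (fun _ _ => Nat.zero_le _) hr)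
    by_cases hs : S.Serves r
    · obtain ⟨t', h3, h4, c, hc, hpc⟩ := hs
      obtain ⟨τ, h5, h6, h7⟩ := S.exists_changes r.page hc (S.cacheAt_succ_mem_trace t)
        (by tauto)
      have h8 := hstart r hr
      have h9 := σ.deadline_le_horizon r (hC hr)
      refine le_add_left (one_le_sum_x (t := τ) ?_ ?_)
      · simp only [rightExt, Finset.mem_Icc]; omega
      · simp only [toIP, Finset.mem_filter, Finset.mem_product, Finset.mem_univ, true_and,
          Finset.mem_range]
        exact ⟨by omega, h7⟩
    · refine le_add_right ?_
      simp [IPSolution.y, toIP, hs, hC hr]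
  · intro c hc hct C hC hcard hinj hpd
    by_cases hsc : S.Serves c
    · obtain ⟨t', h3, h4, d, hd, hpd'⟩ := hsc
      have h1 : ¬ C.image Request.page ⊆ d.erase c.page := by
        intro hsub
        have h2 := Finset.card_le_card hsub
        rw [Finset.card_image_of_injOn hinj, hcard, Finset.card_erase_of_mem hpd'] at h2
        have := hS t' (by omega) _ hd
        have := Finset.card_pos.2 ⟨_, hpd'⟩
        omega
      obtain ⟨p, hp, hpn⟩ := Finset.not_subset.1 h1
      obtain ⟨r, hr, rfl⟩ := Finset.mem_image.1 hp
      have hrd : r.page ∉ d := fun h => hpn (Finset.mem_erase.2 ⟨(hpd r hr).1, h⟩)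
      refine le_add_right (le_trans ?_ (Finset.single_le_sum (f := fun r => (S.toIP σ).y r +
        ∑ t' ∈ doubleExt c r, (S.toIP σ).x r.page t') (fun _ _ => Nat.zero_le _) hr))
      by_cases hs : S.Serves r
      · obtain ⟨t'', h5, h6, e, he, hpe⟩ := hs
        obtain ⟨τ, h7, h8, h9⟩ := S.exists_changes r.page hd he (by tauto)
        have h10 := (hpd r hr).2
        refine le_add_left (one_le_sum_x (t := τ) ?_ ?_)
        · simp only [doubleExt, Finset.mem_Icc]; omega
        · simp only [toIP, Finset.mem_filter, Finset.mem_product, Finset.mem_univ, true_and,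
            Finset.mem_range]
          exact ⟨by omega, h9⟩
      · refine le_add_right ?_
        simp [IPSolution.y, toIP, hs, hC hr]
    · refine le_add_left ?_
      simp [IPSolution.y, toIP, hsc, hc]

open Classical in
theorem card_changes_le (S : Schedule n) (p : Fin n) (T : ℕ) :
    ∑ t ∈ Finset.range T, (if S.Changes p t then 1 else 0)
      ≤ 2 * (∑ t ∈ Finset.range T, evictCount p (S t)) + if p ∈ S.cacheAt T then 1 else 0 := by
  induction T with
  | zero => simp
  | succ T ih =>
    have h := change_le_evictCount p (S T) (S.cacheAt T)
    rw [Finset.sum_range_succ, Finset.sum_range_succ]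
    have h1 : S.cacheAt (T + 1) = (S T).foldl (fun c o => o.apply c) (S.cacheAt T) := rfl
    rw [h1]
    have h2 : (if S.Changes p T then 1 else 0) =
        (if ∃ d ∈ (S T).scanl (fun c o => o.apply c) (S.cacheAt T), ¬ (p ∈ d ↔ p ∈ S.cacheAt T)
          then 1 else 0) := by
      congr 1
    rw [h2]
    omega

theorem sum_stars_toIP_le (S : Schedule n) (σ : Instance n) (w : Fin n → ℝ≥0) :
    ∑ a ∈ (S.toIP σ).stars, (w a.1 : ℝ≥0∞) ≤ 2 * S.evictionCost σ w + ∑ p, (w p : ℝ≥0∞) := by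
  classical
  have h1 : ∑ a ∈ (S.toIP σ).stars, (w a.1 : ℝ≥0∞) = ∑ p, (w p : ℝ≥0∞) *
      ((∑ t ∈ Finset.range (σ.horizon + 1), (if S.Changes p t then 1 else 0) : ℕ) : ℝ≥0∞) := by
    simp only [toIP]
    rw [Finset.sum_filter, Finset.sum_product]
    refine Finset.sum_congr rfl fun p _ => ?_
    rw [Nat.cast_sum, Finset.mul_sum]
    refine Finset.sum_congr rfl fun t _ => ?_
    split_ifs <;> simp
  have h2 : 2 * S.evictionCost σ w + ∑ p, (w p : ℝ≥0∞) = ∑ p, (w p : ℝ≥0∞) *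
      ((2 * (∑ t ∈ Finset.range (σ.horizon + 1), evictCount p (S t)) + 1 : ℕ) : ℝ≥0∞) := by
    unfold evictionCost
    simp only [sum_map_cost]
    rw [Finset.sum_comm, Finset.mul_sum, ← Finset.sum_add_distrib]
    refine Finset.sum_congr rfl fun p _ => ?_
    rw [← Finset.mul_sum]
    push_cast
    ring
  rw [h1, h2]
  refine Finset.sum_le_sum fun p _ => mul_le_mul_right ?_ _
  refine Nat.cast_le.2 ((S.card_changes_le p _).trans ?_)
  split_ifs <;> omega

theorem toIP_cost_le (S : Schedule n) (σ : Instance n) (w : Fin n → ℝ≥0) :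
    (S.toIP σ).cost w ≤ 2 * (S.cost σ w + ∑ p, (w p : ℝ≥0∞)) := by
  classical
  unfold IPSolution.cost cost
  refine (add_le_add (S.sum_stars_toIP_le σ w) le_rfl).trans ?_
  have : ∑ r ∈ (S.toIP σ).penalized, r.penalty
      = ∑ r ∈ σ.requests with ¬ S.Serves r, r.penalty := rfl
  rw [this, mul_add, mul_add, add_right_comm]
  gcongr
  · exact le_mul_of_one_le_left' one_le_two
  · exact le_mul_of_one_le_left' one_le_two

end Schedule

/-! ### Charging arguments -/

theorem sum_le_sum_stars {n : ℕ} {ι : Type*} {w : Fin n → ℝ} (hw : ∀ p, 0 ≤ w p)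
    {X : Finset (Fin n × ℕ)} {D : Finset ι} (f : ι → Fin n × ℕ)
    (hf : ∀ d ∈ D, f d ∈ X) (hinj : Set.InjOn f (D : Set ι)) :
    ∑ d ∈ D, w (f d).1 ≤ ∑ a ∈ X, w a.1 := by
  classical
  rw [← Finset.sum_image (f := fun a : Fin n × ℕ => w a.1) hinj]
  refine Finset.sum_le_sum_of_subset_of_nonneg ?_ fun _ _ _ => hw _
  intro a ha
  obtain ⟨d, hd, rfl⟩ := Finset.mem_image.1 ha
  exact hf d hd

/-- The weight of `q`, rounded down to a power of two, and `0` for weight `0`. It stands for the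
weight class of `q`. -/
noncomputable def unit {n : ℕ} (w : Fin n → ℝ) (q : Fin n) : ℝ :=
  if w q = 0 then 0 else (2 : ℝ) ^ Int.log 2 (w q)

theorem unit_nonneg {n : ℕ} (w : Fin n → ℝ) (q : Fin n) : 0 ≤ unit w q := by
  unfold unit; split_ifs <;> positivity

theorem unit_le {n : ℕ} {w : Fin n → ℝ} (hw : ∀ p, 0 ≤ w p) (q : Fin n) : unit w q ≤ w q := by
  unfold unit
  split_ifs with h
  · exact h.ge
  · have := Int.zpow_log_le_self (b := 2) (r := w q) (by norm_num) (lt_of_le_of_ne (hw q) (Ne.symm h))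
    exact_mod_cast this

theorem le_two_mul_unit {n : ℕ} (w : Fin n → ℝ) (q : Fin n) : w q ≤ 2 * unit w q := by
  unfold unit
  split_ifs with h
  · simp [h]
  · have := Int.lt_zpow_succ_log_self (b := 2) (by norm_num) (w q)
    rw [zpow_add₀ (by norm_num)] at this
    push_cast at this
    linarith

/-- If `u = 2 ^ c` is within a factor of about `n` above `x`, there are `O(log n)` choices
for `c`. -/
theorem mem_Ico_of_comparable {n : ℕ} {x : ℝ} {c : ℤ} (hx : 0 < x)
    (h1 : x < 2 * (2 : ℝ) ^ c) (h2 : (2 : ℝ) ^ c ≤ 2 * n * x) :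
    c ∈ Finset.Ico (Int.log 2 x) (Int.log 2 x + (Nat.log 2 n + 3 : ℕ)) := by
  have h3 := Int.zpow_log_le_self (b := 2) (r := x) (by norm_num) hx
  have h4 := Int.lt_zpow_succ_log_self (b := 2) (by norm_num) x
  push_cast at h3 h4
  have h5 : (n : ℝ) < 2 ^ ((Nat.log 2 n + 1 : ℕ) : ℤ) := by
    rw [zpow_natCast]
    exact_mod_cast Nat.lt_pow_succ_log_self (by norm_num) n
  rw [Finset.mem_Ico]
  constructor
  · have : (2 : ℝ) ^ Int.log 2 x < 2 ^ (c + 1) := by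
      rw [zpow_add₀ (by norm_num)]; linarith
    have := (zpow_lt_zpow_iff_right₀ (by norm_num : (1 : ℝ) < 2)).1 this
    omega
  · have : (2 : ℝ) ^ c < 2 ^ (1 + ((Nat.log 2 n + 1 : ℕ) : ℤ) + (Int.log 2 x + 1)) := by
      rw [zpow_add₀ (by norm_num) _ (Int.log 2 x + 1), zpow_add₀ (by norm_num) 1]
      refine h2.trans_lt ?_
      rw [zpow_one, mul_assoc, mul_assoc]
      gcongr
    have := (zpow_lt_zpow_iff_right₀ (by norm_num : (1 : ℝ) < 2)).1 this
    push_cast at this ⊢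
    omega

/-- If a set of pages has weight at least `u`, half of it is in pages of weight at least
`u / (2 n)`. -/
theorem le_two_mul_sum_filter {n : ℕ} {w : Fin n → ℝ} (Q : Finset (Fin n))
    {u : ℝ} (hu : 0 ≤ u) (h : u ≤ ∑ x ∈ Q, w x) :
    u ≤ 2 * ∑ x ∈ Q with u ≤ 2 * n * w x, w x := by
  rw [← Finset.sum_filter_add_sum_filter_not Q (fun x => u ≤ 2 * n * w x)] at h
  rcases Nat.eq_zero_or_pos n with rfl | hn
  · have : Q = ∅ := Finset.eq_empty_of_isEmpty Q
    subst this
    simpa using h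
  have hn' : (0 : ℝ) < n := by exact_mod_cast hn
  have h1 : ∑ x ∈ Q with ¬ u ≤ 2 * n * w x, w x ≤ u / 2 := by
    calc ∑ x ∈ Q with ¬ u ≤ 2 * n * w x, w x
        ≤ ∑ x ∈ Q with ¬ u ≤ 2 * n * w x, u / (2 * n) := by
          refine Finset.sum_le_sum fun x hx => ?_
          have := (Finset.mem_filter.1 hx).2
          rw [le_div_iff₀ (by positivity)]
          linarith
      _ = (Q.filter fun x => ¬ u ≤ 2 * n * w x).card * (u / (2 * n)) := by
          rw [Finset.sum_const, nsmul_eq_mul]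
      _ ≤ n * (u / (2 * n)) := by
          gcongr
          simpa using Finset.card_le_univ (Q.filter fun x => ¬ u ≤ 2 * n * w x)
      _ = u / 2 := by field_simp
  linarith

open Classical in
/-- The charging scheme, in the abstract. At the times `t ∈ T`, the page `q t` makes room for
visits of the pages in `V t`, in order to serve a request for `p t` that started at time `s t`, and
`q t` has a star since then. If that request was already waiting at an earlier time `t₁` at which
a page of the same weight class made room, then (`hprev`) the pages visited at time `t₁` include
some of this weight that have stars before `t`. The stars until `t₁` are charged once in total
(`hpaid`), and the other ones are charged once for each of the `O(log n)` relevant weight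
classes. -/
theorem sum_unit_le {n : ℕ} {w : Fin n → ℝ} (hw : ∀ p, 0 ≤ w p) (X : Finset (Fin n × ℕ))
    (T : Finset ℕ) (q p : ℕ → Fin n) (s τ : ℕ → ℕ) (V : ℕ → Finset (Fin n))
    (paid : ℕ → Fin n → Prop)
    (hτ : ∀ t ∈ T, (q t, τ t) ∈ X ∧ s t ≤ τ t ∧ τ t ≤ t)
    (hpaid : ∑ t ∈ T, ∑ x ∈ V t with paid t x, w x ≤ ∑ a ∈ X, w a.1)
    (hprev : ∀ t₁ ∈ T, ∀ t₂ ∈ T, t₁ < t₂ → s t₂ ≤ t₁ → unit w (q t₁) = unit w (q t₂) →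
      w (p t₂) < 2 * unit w (q t₂) → ∃ Q ⊆ V t₁, unit w (q t₂) ≤ ∑ x ∈ Q, w x ∧
        ∀ x ∈ Q, w x < 2 * unit w (q t₂) ∧
          (paid t₁ x ∨ ∃ σ, t₁ < σ ∧ σ < t₂ ∧ (x, σ) ∈ X)) :
    ∑ t ∈ T with w (p t) < 2 * unit w (q t), unit w (q t)
      ≤ (3 + 2 * (Nat.log 2 n + 3 : ℕ)) * ∑ a ∈ X, w a.1 := by
  set W := ∑ a ∈ X, w a.1 with hW
  set u : ℕ → ℝ := fun t => unit w (q t) with hu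
  set T' := T.filter fun t => w (p t) < 2 * u t with hT'
  let E : ℕ → Finset ℕ := fun t => T.filter fun t₁ => t₁ < t ∧ u t₁ = u t
  let fresh : ℕ → Prop := fun t => ∀ t₁ ∈ E t, t₁ < s t
  -- the last earlier time of the same class
  let prev : ℕ → ℕ := fun t => (E t).sup id
  have hupos : ∀ t ∈ T', 0 < u t := by
    intro t ht
    have := (Finset.mem_filter.1 ht).2
    have := hw (p t)
    linarith
  have hle_prev : ∀ t, ∀ t₁ ∈ E t, t₁ ≤ prev t := fun t t₁ h => Finset.le_sup (f := id) h
  have hprev_mem : ∀ t, ¬ fresh t → prev t ∈ E t := by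
    intro t ht
    have hne : (E t).Nonempty := by
      by_contra h
      rw [Finset.not_nonempty_iff_eq_empty] at h
      exact ht (by simp [fresh, h])
    obtain ⟨i, hi, h⟩ := Finset.exists_mem_eq_sup (E t) hne id
    simp only [prev, h]
    exact hi
  have hprev_s : ∀ t, ¬ fresh t → s t ≤ prev t := by
    intro t ht
    simp only [fresh, not_forall, not_lt] at ht
    obtain ⟨t₁, h1, h2⟩ := ht
    exact h2.trans (hle_prev t t₁ h1)
  have hprev_lt : ∀ t₁ ∈ T, ∀ t₂, t₁ < t₂ → u t₁ = u t₂ → t₁ ≤ prev t₂ := fun t₁ h1 t₂ h h' =>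
    hle_prev t₂ t₁ (Finset.mem_filter.2 ⟨h1, h, h'⟩)
  -- first use after the start of the request: charge to the star of `q t`
  have hfresh : ∑ t ∈ T' with fresh t, u t ≤ W := by
    refine (Finset.sum_le_sum fun t _ => unit_le hw (q t)).trans ?_
    refine sum_le_sum_stars hw (fun t => (q t, τ t)) ?_ ?_
    · intro t ht
      exact (hτ t (Finset.mem_filter.1 (Finset.mem_filter.1 ht).1).1).1
    · have key : ∀ t₁ ∈ T'.filter fresh, ∀ t₂ ∈ T'.filter fresh,
          (q t₁, τ t₁) = (q t₂, τ t₂) → ¬ t₁ < t₂ := by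
        intro t₁ h1 t₂ h2 he hlt
        have m1 := (Finset.mem_filter.1 (Finset.mem_filter.1 h1).1).1
        have m2 := (Finset.mem_filter.1 (Finset.mem_filter.1 h2).1).1
        simp only [Prod.mk.injEq] at he
        have h3 := (Finset.mem_filter.1 h2).2 t₁
          (Finset.mem_filter.2 ⟨m1, hlt, by simp only [hu, he.1]⟩)
        have := hτ t₁ m1
        have := hτ t₂ m2
        omega
      intro t₁ h1 t₂ h2 he
      have := key t₁ h1 t₂ h2 he
      have := key t₂ h2 t₁ h1 he.symm
      omega
  -- the other uses are charged to the visits at the previous time of the class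
  have hstep : ∀ t ∈ T'.filter fun t => ¬ fresh t,
      u t ≤ 2 * (∑ x ∈ V (prev t) with paid (prev t) x, w x) +
        2 * ∑ a ∈ X with prev t < a.2 ∧ a.2 < t ∧ w a.1 < 2 * u t ∧ u t ≤ 2 * n * w a.1,
          w a.1 := by
    intro t ht
    obtain ⟨ht', hnf⟩ := Finset.mem_filter.1 ht
    obtain ⟨htT, hlight⟩ := Finset.mem_filter.1 ht'
    obtain ⟨hpT, hplt, hpu⟩ := Finset.mem_filter.1 (hprev_mem t hnf)
    obtain ⟨Q, hQV, hQw, hQ⟩ := hprev _ hpT t htT hplt (hprev_s t hnf) hpu hlight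
    have h1 := le_two_mul_sum_filter Q (unit_nonneg w (q t)) hQw
    rw [← Finset.sum_filter_add_sum_filter_not _ (fun x => paid (prev t) x)] at h1
    have h2 : ∑ x ∈ (Q.filter fun x => unit w (q t) ≤ 2 * n * w x) with paid (prev t) x, w x
        ≤ ∑ x ∈ V (prev t) with paid (prev t) x, w x := by
      refine Finset.sum_le_sum_of_subset_of_nonneg ?_ fun _ _ _ => hw _
      intro x hx
      simp only [Finset.mem_filter] at hx ⊢
      exact ⟨hQV hx.1.1, hx.2⟩
    have h3 : ∑ x ∈ (Q.filter fun x => unit w (q t) ≤ 2 * n * w x) with ¬ paid (prev t) x, w x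
        ≤ ∑ a ∈ X with prev t < a.2 ∧ a.2 < t ∧ w a.1 < 2 * u t ∧ u t ≤ 2 * n * w a.1,
          w a.1 := by
      have h4 : ∀ x, ∃ σ, x ∈ Q → ¬ paid (prev t) x → prev t < σ ∧ σ < t ∧ (x, σ) ∈ X := by
        intro x
        by_cases hx : x ∈ Q
        · rcases (hQ x hx).2 with h | ⟨σ, h⟩
          · exact ⟨0, fun _ h' => absurd h h'⟩
          · exact ⟨σ, fun _ _ => h⟩
        · exact ⟨0, fun h => absurd h hx⟩
      choose σ hσ using h4
      refine sum_le_sum_stars hw (fun x => (x, σ x)) ?_ ?_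
      · intro x hx
        simp only [Finset.mem_filter] at hx ⊢
        obtain ⟨h5, h6, h7⟩ := hσ x hx.1.1 hx.2
        exact ⟨h7, h5, h6, (hQ x hx.1.1).1, hx.1.2⟩
      · intro x _ y _ h
        exact (Prod.mk.inj h).1
    simp only [hu] at h3 ⊢
    linarith
  have hsum1 : ∑ t ∈ T' with ¬ fresh t, ∑ x ∈ V (prev t) with paid (prev t) x, w x ≤ W := by
    refine le_trans ?_ hpaid
    rw [← Finset.sum_image (f := fun t => ∑ x ∈ V t with paid t x, w x) (g := prev)]
    · refine Finset.sum_le_sum_of_subset_of_nonneg ?_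
        fun _ _ _ => Finset.sum_nonneg fun _ _ => hw _
      intro t₁ h1
      obtain ⟨t, ht, rfl⟩ := Finset.mem_image.1 h1
      exact (Finset.mem_filter.1 (hprev_mem t (Finset.mem_filter.1 ht).2)).1
    · have key : ∀ t₁ ∈ T'.filter fun t => ¬ fresh t, ∀ t₂ ∈ T'.filter fun t => ¬ fresh t,
          prev t₁ = prev t₂ → ¬ t₁ < t₂ := by
        intro t₁ h1 t₂ h2 he hlt
        have m1 := (Finset.mem_filter.1 (Finset.mem_filter.1 h1).1).1
        have e1 := (Finset.mem_filter.1 (hprev_mem t₁ (Finset.mem_filter.1 h1).2)).2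
        have e2 := (Finset.mem_filter.1 (hprev_mem t₂ (Finset.mem_filter.1 h2).2)).2
        have := hprev_lt t₁ m1 t₂ hlt (by rw [← e1.2, he, e2.2])
        omega
      intro t₁ h1 t₂ h2 he
      have := key t₁ h1 t₂ h2 he
      have := key t₂ h2 t₁ h1 he.symm
      omega
  have hsum2 : ∑ t ∈ T' with ¬ fresh t,
      ∑ a ∈ X with prev t < a.2 ∧ a.2 < t ∧ w a.1 < 2 * u t ∧ u t ≤ 2 * n * w a.1, w a.1
      ≤ (Nat.log 2 n + 3 : ℕ) * W := by
    simp only [Finset.sum_filter (s := X)]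
    rw [Finset.sum_comm, hW, Finset.mul_sum]
    refine Finset.sum_le_sum fun a _ => ?_
    rw [← Finset.sum_filter, Finset.sum_const, nsmul_eq_mul]
    refine mul_le_mul_of_nonneg_right ?_ (hw _)
    -- within a class, the intervals from `prev t` to `t` are disjoint
    refine Nat.cast_le.2 ((Finset.card_le_card_of_injOn (fun t => Int.log 2 (w (q t)))
      (t := Finset.Ico (Int.log 2 (w a.1)) (Int.log 2 (w a.1) + (Nat.log 2 n + 3 : ℕ)))
      ?_ ?_).trans (by simp))
    · intro t ht
      obtain ⟨ht1, -, -, h1, h2⟩ := Finset.mem_filter.1 ht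
      have hpos := hupos t (Finset.mem_filter.1 ht1).1
      have hue : u t = 2 ^ Int.log 2 (w (q t)) := by
        simp only [hu, unit] at hpos ⊢
        split_ifs at hpos ⊢
        · exact absurd hpos (lt_irrefl _)
        · rfl
      refine mem_Ico_of_comparable ?_ (hue ▸ h1) (hue ▸ h2)
      by_contra h
      have : w a.1 = 0 := le_antisymm (not_lt.1 h) (hw _)
      rw [this] at h2
      linarith
    · have key : ∀ t₁ t₂, t₁ ∈ (T'.filter fun t => ¬ fresh t).filter (fun t => prev t < a.2 ∧
          a.2 < t ∧ w a.1 < 2 * u t ∧ u t ≤ 2 * n * w a.1) →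
          t₂ ∈ (T'.filter fun t => ¬ fresh t).filter (fun t => prev t < a.2 ∧
          a.2 < t ∧ w a.1 < 2 * u t ∧ u t ≤ 2 * n * w a.1) →
          Int.log 2 (w (q t₁)) = Int.log 2 (w (q t₂)) → ¬ t₁ < t₂ := by
        intro t₁ t₂ h1 h2 he hlt
        obtain ⟨m1, -, h3, -, -⟩ := Finset.mem_filter.1 h1
        obtain ⟨m2, h4, -, -, -⟩ := Finset.mem_filter.1 h2
        have p1 := hupos _ (Finset.mem_filter.1 m1).1
        have p2 := hupos _ (Finset.mem_filter.1 m2).1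
        have hue : u t₁ = u t₂ := by
          simp only [hu, unit] at p1 p2 ⊢
          split_ifs at p1 p2 ⊢
          all_goals first | exact absurd p1 (lt_irrefl _) | exact absurd p2 (lt_irrefl _) | rw [he]
        have := hprev_lt t₁ (Finset.mem_filter.1 (Finset.mem_filter.1 m1).1).1 t₂ hlt hue
        omega
      intro t₁ h1 t₂ h2 he
      have := key t₁ t₂ h1 h2 he
      have := key t₂ t₁ h2 h1 he.symm
      omega
  have hnf := Finset.sum_le_sum hstep
  rw [Finset.sum_add_distrib, ← Finset.mul_sum, ← Finset.mul_sum] at hnf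
  rw [← Finset.sum_filter_add_sum_filter_not T' fresh]
  linarith

/-! ### The conversion algorithm -/

open Classical in
/-- The pages that have to be in the cache after time `t`: those with a request that has ended, is
not penalized, and has had no star since its start. -/
noncomputable def required {n : ℕ} (o : Observation n) (t : ℕ) : Finset (Fin n) :=
  {p | ∃ r ∈ o.requests, r.page = p ∧ r.deadline ≤ t ∧ r ∉ o.penalized ∧
    ∀ τ, r.start ≤ τ → τ ≤ t → (p, τ) ∉ o.stars}

open Classical in
/-- The requests at time `t` that wait for being served; `seen` contains the pairs `(p, t')` such
that `p` is known to have been in the cache at the earlier time `t'`. -/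
noncomputable def outstanding {n : ℕ} (o : Observation n) (t : ℕ) (seen : Finset (Fin n × ℕ)) :
    Finset (Request n) :=
  {r ∈ o.requests | t ≤ r.deadline ∧ r ∉ o.penalized ∧ r.page ∉ required o t ∧
    ∀ t', r.start ≤ t' → t' < t → (r.page, t') ∉ seen}

open Classical in
/-- The pages lighter than `2 * u` with a request in `O` that ends before time `d`. -/
noncomputable def backlog {n : ℕ} (w : Fin n → ℝ) (u : ℝ) (O : Finset (Request n)) (d : ℕ) :
    Finset (Fin n) :=
  (O.filter fun r => w r.page < 2 * u ∧ r.deadline < d).image Request.page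

open Classical in
/-- The pages of the light requests in `O` in the order of their deadlines, until the total weight
is at least `u`. -/
noncomputable def batch {n : ℕ} (w : Fin n → ℝ) (u : ℝ) (O : Finset (Request n)) :
    Finset (Fin n) :=
  (O.filter fun r => w r.page < 2 * u ∧ ∑ p ∈ backlog w u O r.deadline, w p < u).image
    Request.page

theorem sum_batch_le {n : ℕ} {w : Fin n → ℝ} (hw : ∀ p, 0 ≤ w p) {u : ℝ} (hu : 0 ≤ u)
    {O : Finset (Request n)} (hO : Set.InjOn Request.deadline (O : Set (Request n))) :
    ∑ p ∈ batch w u O, w p ≤ 3 * u := by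
  classical
  set D := O.filter fun r => w r.page < 2 * u ∧ ∑ p ∈ backlog w u O r.deadline, w p < u with hD
  by_cases hne : D.Nonempty
  · -- all pages but the last one are in the backlog of the last one
    obtain ⟨m, hm, hmax⟩ := D.exists_max_image Request.deadline hne
    obtain ⟨hmO, hm1, hm2⟩ := Finset.mem_filter.1 hm
    have hsub : batch w u O ⊆ insert m.page (backlog w u O m.deadline) := by
      intro p hp
      obtain ⟨r, hr, rfl⟩ := Finset.mem_image.1 hp
      obtain ⟨hrO, hr1, hr2⟩ := Finset.mem_filter.1 hr
      rcases (hmax r hr).lt_or_eq with h | h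
      · exact Finset.mem_insert_of_mem
          (Finset.mem_image.2 ⟨r, Finset.mem_filter.2 ⟨hrO, hr1, h⟩, rfl⟩)
      · rw [hO hrO hmO h]
        exact Finset.mem_insert_self _ _
    calc ∑ p ∈ batch w u O, w p
        ≤ ∑ p ∈ insert m.page (backlog w u O m.deadline), w p :=
          Finset.sum_le_sum_of_subset_of_nonneg hsub fun _ _ _ => hw _
      _ ≤ w m.page + ∑ p ∈ backlog w u O m.deadline, w p := by
          by_cases h : m.page ∈ backlog w u O m.deadline
          · rw [Finset.insert_eq_of_mem h]
            linarith [hw m.page]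
          · rw [Finset.sum_insert h]
      _ ≤ 3 * u := by linarith
  · have : batch w u O = ∅ := by
      unfold batch
      rw [← hD, Finset.not_nonempty_iff_eq_empty.1 hne, Finset.image_empty]
    rw [this, Finset.sum_empty]
    linarith

/-- A light request is passed over by the batch only in favour of a weight of at least `u` in pages
with earlier deadlines. -/
theorem exists_subset_batch {n : ℕ} {w : Fin n → ℝ} {u : ℝ} {O : Finset (Request n)}
    {r : Request n} (hr : r ∈ O) (hlight : w r.page < 2 * u) (hnot : r.page ∉ batch w u O) :
    ∃ Q ⊆ batch w u O, u ≤ ∑ p ∈ Q, w p ∧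
      ∀ p ∈ Q, ∃ r' ∈ O, r'.page = p ∧ w p < 2 * u ∧ r'.deadline < r.deadline := by
  classical
  -- the first request that is passed over
  obtain ⟨m, hm, hmin⟩ := (O.filter fun r => w r.page < 2 * u ∧
    r.page ∉ batch w u O).exists_min_image Request.deadline
      ⟨r, Finset.mem_filter.2 ⟨hr, hlight, hnot⟩⟩
  obtain ⟨hmO, hm1, hm2⟩ := Finset.mem_filter.1 hm
  have hmr := hmin r (Finset.mem_filter.2 ⟨hr, hlight, hnot⟩)
  refine ⟨backlog w u O m.deadline, ?_, ?_, ?_⟩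
  · intro p hp
    obtain ⟨r', hr', rfl⟩ := Finset.mem_image.1 hp
    obtain ⟨h1, h2, h3⟩ := Finset.mem_filter.1 hr'
    by_contra h
    have := hmin r' (Finset.mem_filter.2 ⟨h1, h2, h⟩)
    omega
  · by_contra h
    exact hm2 (Finset.mem_image.2 ⟨m, Finset.mem_filter.2 ⟨hmO, hm1, not_le.1 h⟩, rfl⟩)
  · intro p hp
    obtain ⟨r', hr', rfl⟩ := Finset.mem_image.1 hp
    obtain ⟨h1, h2, h3⟩ := Finset.mem_filter.1 hr'
    exact ⟨r', h1, rfl, h2, by omega⟩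

/-- `q` is a required page that has had a star since the start of `c`, and it is needed as all `k`
places of the cache are taken. -/
def CanMakeRoom {n : ℕ} (k : ℕ) (o : Observation n) (t : ℕ) (c : Request n) (q : Fin n) : Prop :=
  k ≤ (required o t).card ∧ q ∈ required o t ∧
    ∃ τ, c.start ≤ τ ∧ τ ≤ t ∧ (q, τ) ∈ o.stars

open Classical in
/-- The page that makes room for serving the critical request `c`, if the cache is full. -/
noncomputable def slotFor {n : ℕ} (k : ℕ) (o : Observation n) (t : ℕ) (c : Request n) :
    Option (Fin n) :=
  if h : ∃ q, CanMakeRoom k o t c q then some h.choose else none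

open Classical in
/-- What is done at time `t` for the outstanding requests: the page that is removed for a moment,
if there is one, and the pages that are loaded for a moment. Nothing is done unless there is a
critical request, which ends now. -/
noncomputable def decision {n : ℕ} (k : ℕ) (w : Fin n → ℝ) (o : Observation n) (t : ℕ)
    (seen : Finset (Fin n × ℕ)) : Option (Fin n) × Finset (Fin n) :=
  if h : ∃ c ∈ outstanding o t seen, c.deadline = t then
    (slotFor k o t h.choose, insert h.choose.page
      ((slotFor k o t h.choose).elim ∅ fun q => batch w (unit w q) (outstanding o t seen)))
  else (none, ∅)

/-- The state of the algorithm: the time, the content of the cache, and a record of pairs `(p, t)`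
such that `p` was in the cache at time `t`. -/
structure AlgState (n : ℕ) where
  time : ℕ
  cache : Finset (Fin n)
  seen : Finset (Fin n × ℕ)

/-- The initial state. -/
def AlgState.init (n : ℕ) : AlgState n := ⟨0, ∅, ∅⟩

open Classical in
/-- The state after the time with observation `o`. -/
noncomputable def AlgState.next {n : ℕ} (k : ℕ) (w : Fin n → ℝ) (s : AlgState n)
    (o : Observation n) : AlgState n where
  time := s.time + 1
  cache := required o s.time
  seen := s.seen ∪ (required o s.time ∪ (decision k w o s.time s.seen).2) ×ˢ {s.time}

/-- Loading the pages of a list one after the other, each for a moment. -/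
def visitOps {n : ℕ} (l : List (Fin n)) : List (Op n) :=
  l.flatMap fun p => [Op.load p, Op.evict p]

/-- The operations that lead from the cache `R` to the cache `R'` and then visit the pages in `V`,
where the page in `slot` makes room. -/
noncomputable def stepOps {n : ℕ} (R R' : Finset (Fin n)) (slot : Option (Fin n))
    (V : Finset (Fin n)) : List (Op n) :=
  (R \ R').toList.map Op.evict ++ ((R' \ R).toList.map Op.load ++
    (slot.toList.map Op.evict ++ (visitOps V.toList ++ slot.toList.map Op.load)))

/-- The operations at the time with observation `o`. -/
noncomputable def AlgState.ops {n : ℕ} (k : ℕ) (w : Fin n → ℝ) (s : AlgState n)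
    (o : Observation n) : List (Op n) :=
  stepOps s.cache (required o s.time) (decision k w o s.time s.seen).1
    (decision k w o s.time s.seen).2

/-- The conversion algorithm. -/
noncomputable def conversion {n : ℕ} (k : ℕ) (w : Fin n → ℝ) : OnlineAlgorithm n := fun L =>
  (L.foldl (fun a o => (a.1.next k w o, a.1.ops k w o)) (AlgState.init n, [])).2

/-- The state at the beginning of time `t`. -/
noncomputable def stateAt {n : ℕ} (k : ℕ) (w : Fin n → ℝ) (o : ℕ → Observation n) :
    ℕ → AlgState n
  | 0 => AlgState.init n
  | t + 1 => (stateAt k w o t).next k w (o t)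

theorem run_conversion {n : ℕ} (k : ℕ) (w : Fin n → ℝ) (σ : Instance n) (A : ℕ → IPSolution n)
    (t : ℕ) : (conversion k w).run σ A t
      = (stateAt k w (observe σ A) t).ops k w (observe σ A t) := by
  have key : ∀ t, (((List.range t).map (observe σ A)).foldl
      (fun a o => (a.1.next k w o, a.1.ops k w o)) (AlgState.init n, ([] : List (Op n)))).1
      = stateAt k w (observe σ A) t := by
    intro t
    induction t with
    | zero => rfl
    | succ t ih =>
      rw [List.range_succ, List.map_append, List.foldl_append]
      simp [ih, stateAt]
  unfold OnlineAlgorithm.run conversion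
  rw [List.range_succ, List.map_append, List.foldl_append]
  simp [key]

theorem stateAt_time {n : ℕ} (k : ℕ) (w : Fin n → ℝ) (o : ℕ → Observation n) (t : ℕ) :
    (stateAt k w o t).time = t := by
  induction t with
  | zero => rfl
  | succ t ih => simp [stateAt, AlgState.next, ih]

theorem mem_seen {n : ℕ} {k : ℕ} {w : Fin n → ℝ} {o : ℕ → Observation n} {t : ℕ}
    {p : Fin n} {t' : ℕ} : (p, t') ∈ (stateAt k w o t).seen ↔ t' < t ∧
      (p ∈ required (o t') t' ∨ p ∈ (decision k w (o t') t' (stateAt k w o t').seen).2) := by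
  induction t with
  | zero => simp [stateAt, AlgState.init]
  | succ t ih =>
    simp only [stateAt, AlgState.next, stateAt_time, Finset.mem_union, ih, Finset.mem_product,
      Finset.mem_singleton]
    constructor
    · rintro (⟨h1, h2⟩ | ⟨h1, rfl⟩)
      · exact ⟨by omega, h2⟩
      · exact ⟨by omega, h1⟩
    · rintro ⟨h1, h2⟩
      rcases (by omega : t' < t ∨ t' = t) with h | rfl
      · exact Or.inl ⟨h, h2⟩
      · exact Or.inr ⟨h2, rfl⟩

/-! ### Execution of the operations of one time -/

/-- The operations `l` lead from the cache `c` to the cache `d`, with at most `k` pages in the cache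
all the time. -/
def Leads {n : ℕ} (k : ℕ) (c : Finset (Fin n)) (l : List (Op n)) (d : Finset (Fin n)) : Prop :=
  l.foldl (fun c o => o.apply c) c = d ∧ ∀ e ∈ l.scanl (fun c o => o.apply c) c, e.card ≤ k

theorem mem_scanl_append {α β : Type*} (f : β → α → β) (b : β) (l₁ l₂ : List α) (x : β) :
    x ∈ (l₁ ++ l₂).scanl f b ↔ x ∈ l₁.scanl f b ∨ x ∈ l₂.scanl f (l₁.foldl f b) := by
  induction l₁ generalizing b with
  | nil =>
    simp only [List.nil_append, List.scanl_nil, List.foldl_nil, List.mem_singleton]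
    constructor
    · exact Or.inr
    · rintro (rfl | h)
      · cases l₂ <;> simp [List.scanl_cons]
      · exact h
  | cons a l ih => simp [List.scanl_cons, ih, or_assoc]

theorem Leads.append {n k : ℕ} {c d e : Finset (Fin n)} {l₁ l₂ : List (Op n)}
    (h1 : Leads k c l₁ d) (h2 : Leads k d l₂ e) : Leads k c (l₁ ++ l₂) e := by
  refine ⟨by rw [List.foldl_append, h1.1, h2.1], fun x hx => ?_⟩
  rw [mem_scanl_append, h1.1] at hx
  exact hx.elim (h1.2 x) (h2.2 x)

theorem Leads.nil {n k : ℕ} {c : Finset (Fin n)} (h : c.card ≤ k) : Leads k c [] c :=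
  ⟨rfl, by simpa using h⟩

theorem Leads.cons {n k : ℕ} {c d : Finset (Fin n)} {o : Op n} {l : List (Op n)}
    (hc : c.card ≤ k) (h : Leads k (o.apply c) l d) : Leads k c (o :: l) d := by
  refine ⟨h.1, fun e he => ?_⟩
  rw [List.scanl_cons, List.mem_cons] at he
  rcases he with rfl | he
  · exact hc
  · exact h.2 e he

theorem leads_evict {n k : ℕ} {c : Finset (Fin n)} (l : List (Fin n)) (hc : c.card ≤ k) :
    Leads k c (l.map Op.evict) (c \ l.toFinset) := by
  induction l generalizing c with
  | nil => simpa using Leads.nil hc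
  | cons p l ih =>
    refine Leads.cons hc ?_
    have h := ih (c := c.erase p) ((Finset.card_le_card (Finset.erase_subset _ _)).trans hc)
    have he : c \ (p :: l).toFinset = c.erase p \ l.toFinset := by
      ext x
      simp
      tauto
    rw [he]
    exact h

theorem leads_load {n k : ℕ} {c : Finset (Fin n)} (l : List (Fin n))
    (hc : (c ∪ l.toFinset).card ≤ k) : Leads k c (l.map Op.load) (c ∪ l.toFinset) := by
  induction l generalizing c with
  | nil => simpa using Leads.nil (by simpa using hc)
  | cons p l ih =>
    refine Leads.cons ((Finset.card_le_card Finset.subset_union_left).trans hc) ?_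
    have he : c ∪ (p :: l).toFinset = insert p c ∪ l.toFinset := by
      ext x
      simp
    rw [he] at hc ⊢
    exact ih hc

theorem leads_visitOps {n k : ℕ} {c : Finset (Fin n)} (l : List (Fin n))
    (hl : ∀ p ∈ l, p ∉ c) (hc : c.card ≤ k) (hlt : l ≠ [] → c.card < k) :
    Leads k c (visitOps l) c := by
  induction l with
  | nil => exact Leads.nil hc
  | cons p l ih =>
    have hp : p ∉ c := hl p (by simp)
    have hk := hlt (by simp)
    have h := ih (fun x hx => hl x (by simp [hx])) fun _ => hk
    show Leads k c (Op.load p :: Op.evict p :: visitOps l) c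
    refine Leads.cons hc (Leads.cons ?_ ?_)
    · simp only [Op.apply, Finset.card_insert_of_notMem hp]
      omega
    · simpa only [Op.apply, Finset.erase_insert hp] using h

theorem mem_scanl_visitOps {n : ℕ} {c : Finset (Fin n)} {l : List (Fin n)} {p : Fin n}
    (hp : p ∈ l) : ∃ d ∈ (visitOps l).scanl (fun c o => o.apply c) c, p ∈ d := by
  induction l generalizing c with
  | nil => simp at hp
  | cons q l ih =>
    have he : visitOps (q :: l) = Op.load q :: Op.evict q :: visitOps l := rfl
    rw [he, List.scanl_cons, List.scanl_cons]
    by_cases h : p = q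
    · exact ⟨insert q c, by simp [Op.apply], by simp [h]⟩
    · obtain ⟨d, hd, hpd⟩ := ih (c := (insert q c).erase q)
        ((List.mem_cons.1 hp).resolve_left h)
      exact ⟨d, List.mem_cons_of_mem _ (List.mem_cons_of_mem _ hd), hpd⟩

theorem leads_stepOps {n k : ℕ} {R R' V : Finset (Fin n)} {slot : Option (Fin n)}
    (hR : R.card ≤ k) (hR' : R'.card ≤ k) (hV : ∀ p ∈ V, p ∉ R')
    (hslot : ∀ q ∈ slot, q ∈ R') (hfull : V.Nonempty → slot = none → R'.card < k) :
    Leads k R (stepOps R R' slot V) R' := by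
  have h1 := leads_evict (R \ R').toList hR
  have h2 : Leads k (R \ (R \ R').toList.toFinset) ((R' \ R).toList.map Op.load) R' := by
    have he : R \ (R \ R').toList.toFinset ∪ (R' \ R).toList.toFinset = R' := by
      ext x
      simp
      tauto
    have := leads_load (k := k) (c := R \ (R \ R').toList.toFinset) (R' \ R).toList
      (by rw [he]; exact hR')
    rwa [he] at this
  refine h1.append (h2.append ?_)
  cases slot with
  | none =>
    refine (leads_visitOps _ (by simpa using hV) hR' ?_).append (Leads.nil hR')
    intro h
    exact hfull (by rw [Finset.nonempty_iff_ne_empty]; simpa using h) rfl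
  | some q =>
    have hq := hslot q rfl
    have hpos := Finset.card_pos.2 ⟨q, hq⟩
    have h3 := leads_evict [q] hR'
    have he : R' \ [q].toFinset = R'.erase q := by
      ext x
      simp
      tauto
    rw [he] at h3
    refine h3.append ((leads_visitOps _ (fun p hp => ?_) ?_ fun _ => ?_).append ?_)
    · simp only [Finset.mem_toList] at hp
      simp [hV p hp]
    · rw [Finset.card_erase_of_mem hq]; omega
    · rw [Finset.card_erase_of_mem hq]; omega
    · have he' : R'.erase q ∪ [q].toFinset = R' := by
        ext x
        simp
        grind
      have := leads_load (k := k) (c := R'.erase q) [q] (by rw [he']; exact hR')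
      rwa [he'] at this

theorem mem_scanl_stepOps {n : ℕ} (R R' : Finset (Fin n)) {V : Finset (Fin n)}
    (slot : Option (Fin n)) {p : Fin n} (hp : p ∈ V) :
    ∃ d ∈ (stepOps R R' slot V).scanl (fun c o => o.apply c) R, p ∈ d := by
  unfold stepOps
  simp only [mem_scanl_append]
  obtain ⟨d, hd, h⟩ := mem_scanl_visitOps (c := (slot.toList.map Op.evict).foldl
    (fun c o => o.apply c) (((R' \ R).toList.map Op.load).foldl (fun c o => o.apply c)
      (((R \ R').toList.map Op.evict).foldl (fun c o => o.apply c) R)))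
    (Finset.mem_toList.2 hp)
  exact ⟨d, Or.inr (Or.inr (Or.inr (Or.inl hd))), h⟩

theorem cost_stepOps {n : ℕ} (w : Fin n → ℝ≥0) (R R' V : Finset (Fin n))
    (slot : Option (Fin n)) :
    ((stepOps R R' slot V).map (Op.cost w)).sum = ENNReal.ofReal
      (∑ p ∈ R \ R', (w p : ℝ) + slot.elim 0 (fun q => (w q : ℝ)) + ∑ p ∈ V, (w p : ℝ)) := by
  have h1 : ∀ l : List (Fin n), ((l.map Op.evict).map (Op.cost w)).sum
      = (l.map fun p => (w p : ℝ≥0∞)).sum := by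
    intro l; rw [List.map_map]; rfl
  have h2 : ∀ l : List (Fin n), ((l.map Op.load).map (Op.cost w)).sum = 0 := by
    intro l; induction l <;> simp_all [Op.cost]
  have h3 : ∀ l : List (Fin n), ((visitOps l).map (Op.cost w)).sum
      = (l.map fun p => (w p : ℝ≥0∞)).sum := by
    intro l
    induction l with
    | nil => rfl
    | cons p l ih =>
      have he : visitOps (p :: l) = Op.load p :: Op.evict p :: visitOps l := rfl
      rw [he]
      simp only [List.map_cons, List.sum_cons, ih, Op.cost, zero_add]
  have h4 : ∀ s : Finset (Fin n), (s.toList.map fun p => (w p : ℝ≥0∞)).sum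
      = ENNReal.ofReal (∑ p ∈ s, (w p : ℝ)) := by
    intro s
    rw [Finset.sum_map_toList, ENNReal.ofReal_sum_of_nonneg fun _ _ => NNReal.coe_nonneg _]
    simp
  have hnn : ∀ s : Finset (Fin n), 0 ≤ ∑ p ∈ s, (w p : ℝ) := fun s =>
    Finset.sum_nonneg fun _ _ => NNReal.coe_nonneg _
  unfold stepOps
  simp only [List.map_append, List.sum_append, h1, h2, h3, h4]
  cases slot with
  | none => simp [ENNReal.ofReal_add, hnn]
  | some q => simp [ENNReal.ofReal_add, add_nonneg, hnn, add_assoc]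

/-! ### Correctness of the algorithm -/

/-- The pages required after time `t`. -/
noncomputable abbrev requiredAt {n : ℕ} (σ : Instance n) (A : ℕ → IPSolution n) (t : ℕ) :
    Finset (Fin n) :=
  required (observe σ A t) t

/-- The outstanding requests at time `t`. -/
noncomputable abbrev outstandingAt {n : ℕ} (k : ℕ) (w : Fin n → ℝ) (σ : Instance n)
    (A : ℕ → IPSolution n) (t : ℕ) : Finset (Request n) :=
  outstanding (observe σ A t) t (stateAt k w (observe σ A) t).seen

/-- The page that makes room at time `t`, and the pages visited. -/
noncomputable abbrev decisionAt {n : ℕ} (k : ℕ) (w : Fin n → ℝ) (σ : Instance n)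
    (A : ℕ → IPSolution n) (t : ℕ) : Option (Fin n) × Finset (Fin n) :=
  decision k w (observe σ A t) t (stateAt k w (observe σ A) t).seen

variable {n k : ℕ} {w : Fin n → ℝ} {σ : Instance n} {A : ℕ → IPSolution n}

theorem mem_requiredAt {t : ℕ} {p : Fin n} : p ∈ requiredAt σ A t ↔
    ∃ r ∈ σ.requests, r.page = p ∧ r.deadline ≤ t ∧ r ∉ (A t).penalized ∧
      ∀ τ, r.start ≤ τ → τ ≤ t → (p, τ) ∉ (A t).stars := by
  rw [requiredAt, required, Finset.mem_filter_univ]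
  simp only [observe, Instance.revealed, Finset.mem_filter]
  constructor
  · rintro ⟨r, ⟨h1, -⟩, h2, h3, h4, h5⟩
    exact ⟨r, h1, h2, h3, h4, fun τ h6 h7 h8 => h5 τ h6 h7 ⟨h8, h7⟩⟩
  · rintro ⟨r, h1, h2, h3, h4, h5⟩
    have := σ.start_le_deadline r h1
    exact ⟨r, ⟨h1, by omega⟩, h2, h3, h4, fun τ h6 h7 h8 => h5 τ h6 h7 h8.1⟩

theorem mem_outstandingAt {t : ℕ} {r : Request n} : r ∈ outstandingAt k w σ A t ↔
    r ∈ σ.requests ∧ r.start ≤ t ∧ t ≤ r.deadline ∧ r ∉ (A t).penalized ∧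
      r.page ∉ requiredAt σ A t ∧ ∀ t', r.start ≤ t' → t' < t →
        r.page ∉ requiredAt σ A t' ∧ r.page ∉ (decisionAt k w σ A t').2 := by
  simp only [outstandingAt, outstanding, Finset.mem_filter, mem_seen]
  simp only [observe, Instance.revealed, Finset.mem_filter]
  constructor
  · rintro ⟨⟨h1, h2⟩, h3, h4, h5, h6⟩
    refine ⟨h1, h2, h3, h4, h5, fun t' h7 h8 => ?_⟩
    have := h6 t' h7 h8
    push Not at this
    exact this h8
  · rintro ⟨h1, h2, h3, h4, h5, h6⟩
    exact ⟨⟨h1, h2⟩, h3, h4, h5, fun t' h7 h8 h9 => h9.2.elim (h6 t' h7 h8).1 (h6 t' h7 h8).2⟩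

theorem IsOnlineSolution.le (hA : IsOnlineSolution σ k A) {t t' : ℕ} (h : t ≤ t')
    (ht' : t' ≤ σ.horizon) :
    (A t).stars ⊆ (A t').stars ∧ (A t).penalized ⊆ (A t').penalized ∧
      (∀ a ∈ (A t').stars, a.2 ≤ t → a ∈ (A t).stars) ∧
      ∀ r ∈ (A t').penalized, r.deadline ≤ t → r ∈ (A t).penalized := by
  induction t', h using Nat.le_induction with
  | base => exact ⟨subset_rfl, subset_rfl, fun _ h _ => h, fun _ h _ => h⟩
  | succ m hm ih =>
    obtain ⟨h1, h2, h3, h4⟩ := ih (by omega)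
    obtain ⟨h5, h6⟩ := hA.monotone m (by omega)
    refine ⟨h1.trans h5, h2.trans h6, fun a ha hat => h3 a ?_ hat, fun r hr hrt => h4 r ?_ hrt⟩
    · by_contra hc
      have := hA.past_stars m (by omega) a ha hc
      omega
    · by_contra hc
      have := hA.past_penalized m (by omega) r hr hc
      omega

theorem exists_of_one_le_sum {B : IPSolution n} {C : Finset (Request n)}
    {I : Request n → Finset ℕ} (h : 1 ≤ ∑ r ∈ C, (B.y r + ∑ t' ∈ I r, B.x r.page t')) :
    ∃ r ∈ C, r ∈ B.penalized ∨ ∃ t' ∈ I r, (r.page, t') ∈ B.stars := by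
  by_contra! H
  have : ∑ r ∈ C, (B.y r + ∑ t' ∈ I r, B.x r.page t') = 0 := by
    refine Finset.sum_eq_zero fun r hr => ?_
    have h1 : B.y r = 0 := by simp [IPSolution.y, (H r hr).1]
    have h2 : ∀ t' ∈ I r, B.x r.page t' = 0 := fun t' ht' => by
      simp [IPSolution.x, (H r hr).2 t' ht']
    rw [h1, Finset.sum_eq_zero h2, add_zero]
  omega

/-- Requests that witness that the pages in `R` are required. -/
theorem exists_witnesses {t : ℕ} {R : Finset (Fin n)} (hR : R ⊆ requiredAt σ A t) :
    ∃ C ⊆ σ.requests, C.card = R.card ∧ Set.InjOn Request.page (C : Set (Request n)) ∧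
      ∀ r ∈ C, r.page ∈ R ∧ r.deadline ≤ t ∧ r ∉ (A t).penalized ∧
        ∀ τ, r.start ≤ τ → τ ≤ t → (r.page, τ) ∉ (A t).stars := by
  classical
  have h : ∀ p, ∃ r, p ∈ R → r ∈ σ.requests ∧ r.page = p ∧ r.deadline ≤ t ∧
      r ∉ (A t).penalized ∧ ∀ τ, r.start ≤ τ → τ ≤ t → (p, τ) ∉ (A t).stars := by
    intro p
    by_cases hp : p ∈ R
    · obtain ⟨r, hr⟩ := mem_requiredAt.1 (hR hp)
      exact ⟨r, fun _ => hr⟩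
    · exact ⟨⟨p, 0, 0, 0⟩, fun h => absurd h hp⟩
  choose g hg using h
  refine ⟨R.image g, ?_, Finset.card_image_of_injOn ?_, ?_, ?_⟩
  · intro r hr
    obtain ⟨p, hp, rfl⟩ := Finset.mem_image.1 hr
    exact (hg p hp).1
  · intro p hp p' hp' he
    rw [← (hg p hp).2.1, ← (hg p' hp').2.1, he]
  · intro r hr r' hr' he
    obtain ⟨p, hp, rfl⟩ := Finset.mem_image.1 hr
    obtain ⟨p', hp', rfl⟩ := Finset.mem_image.1 hr'
    rw [(hg p hp).2.1, (hg p' hp').2.1] at he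
    rw [he]
  · intro r hr
    obtain ⟨p, hp, rfl⟩ := Finset.mem_image.1 hr
    obtain ⟨-, h2, h3, h4, h5⟩ := hg p hp
    rw [h2]
    exact ⟨hp, h3, h4, h5⟩

theorem card_requiredAt_le (hA : IsOnlineSolution σ k A) {t : ℕ} (ht : t ≤ σ.horizon) :
    (requiredAt σ A t).card ≤ k := by
  by_contra! h
  obtain ⟨R, hR, hcard⟩ := Finset.exists_subset_card_eq (Nat.succ_le_of_lt h)
  obtain ⟨C, hC, hCc, hinj, hw⟩ := exists_witnesses hR
  have hc := (hA.feasible t ht t le_rfl).1 C hC (hCc.trans hcard) hinj fun r hr =>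
    (σ.start_le_deadline r (hC hr)).trans (hw r hr).2.1
  obtain ⟨r, hr, h1 | ⟨t', h1, h2⟩⟩ := exists_of_one_le_sum hc
  · exact (hw r hr).2.2.1 h1
  · have h3 := (hw r hr).2.1
    simp only [rightExt, Finset.mem_Icc] at h1
    exact (hw r hr).2.2.2 t' h1.1 (by omega) h2

/-- When the cache is full of required pages, the right extension constraints provide a star for
every outstanding request. -/
theorem exists_star_of_full (hA : IsOnlineSolution σ k A) {t : ℕ} (ht : t ≤ σ.horizon)
    (hfull : k ≤ (requiredAt σ A t).card) {r : Request n} (hr : r ∈ outstandingAt k w σ A t) :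
    ∃ τ, r.start ≤ τ ∧ τ ≤ r.deadline ∧ (r.page, τ) ∈ (A t).stars := by
  classical
  obtain ⟨h1, h2, h3, h4, h5, -⟩ := mem_outstandingAt.1 hr
  obtain ⟨C, hC, hCc, hinj, hw⟩ := exists_witnesses (subset_refl (requiredAt σ A t))
  have hrC : ∀ r' ∈ C, r'.page ≠ r.page := fun r' hr' he => h5 (he ▸ (hw r' hr').1)
  have hrn : r ∉ C := fun h => hrC r h rfl
  have hc := (hA.feasible t ht t le_rfl).1 (insert r C)
    (Finset.insert_subset h1 hC)
    (by rw [Finset.card_insert_of_notMem hrn, hCc]; have := card_requiredAt_le hA ht; omega)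
    (by
      rw [Finset.coe_insert, Set.injOn_insert (by simpa using hrn)]
      refine ⟨hinj, ?_⟩
      rintro ⟨r', hr', he⟩
      exact hrC r' hr' he)
    (by
      intro r' hr'
      rcases Finset.mem_insert.1 hr' with rfl | hr'
      · exact h2
      · exact (σ.start_le_deadline r' (hC hr')).trans (hw r' hr').2.1)
  obtain ⟨r', hr', hs⟩ := exists_of_one_le_sum hc
  rcases Finset.mem_insert.1 hr' with rfl | hr'
  · obtain h | ⟨τ, h6, h7⟩ := hs
    · exact absurd h h4
    · simp only [rightExt, Finset.mem_Icc] at h6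
      exact ⟨τ, h6.1, by omega, h7⟩
  · obtain h | ⟨τ, h6, h7⟩ := hs
    · exact absurd h (hw r' hr').2.2.1
    · have h8 := (hw r' hr').2.1
      simp only [rightExt, Finset.mem_Icc] at h6
      exact absurd h7 ((hw r' hr').2.2.2 τ h6.1 (by omega))

/-- The double extension constraints provide a page that can make room for a critical request. -/
theorem exists_canMakeRoom (hA : IsOnlineSolution σ k A) {t : ℕ} (ht : t ≤ σ.horizon)
    (hfull : k ≤ (requiredAt σ A t).card) {c : Request n} (hc : c ∈ outstandingAt k w σ A t)
    (hct : c.deadline = t) : ∃ q, CanMakeRoom k (observe σ A t) t c q := by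
  obtain ⟨h1, h2, h3, h4, h5, -⟩ := mem_outstandingAt.1 hc
  obtain ⟨C, hC, hCc, hinj, hw⟩ := exists_witnesses (subset_refl (requiredAt σ A t))
  have hd := (hA.feasible t ht t le_rfl).2 c h1 hct C hC
    (le_antisymm (hCc.trans_le (card_requiredAt_le hA ht)) (hCc ▸ hfull)) hinj
    fun r hr => ⟨fun he => h5 (he ▸ (hw r hr).1), (hw r hr).2.1⟩
  have hy : (A t).y c = 0 := by simp [IPSolution.y, h4]
  rw [hy, add_zero] at hd
  obtain ⟨r, hr, h | ⟨τ, h6, h7⟩⟩ := exists_of_one_le_sum hd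
  · exact absurd h (hw r hr).2.2.1
  · obtain ⟨hr1, hr2, hr3, hr4⟩ := hw r hr
    simp only [doubleExt, Finset.mem_Icc, hct] at h6
    -- the star is not in the interval of the witness `r`, and thus in the one of `c`
    have h8 : ¬ r.start ≤ τ := fun h => hr4 τ h h6.2 h7
    exact ⟨r.page, hfull, hr1, τ, by omega, h6.2, by
      simp only [observe, Finset.mem_filter]; exact ⟨h7, h6.2⟩⟩

/-- A request that is critical has a star, as its page would be required otherwise. -/
theorem exists_star_of_critical {t : ℕ} {c : Request n} (hc : c ∈ outstandingAt k w σ A t)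
    (hct : c.deadline = t) : ∃ τ, c.start ≤ τ ∧ τ ≤ t ∧ (c.page, τ) ∈ (A t).stars := by
  obtain ⟨h1, h2, h3, h4, h5, -⟩ := mem_outstandingAt.1 hc
  by_contra! H
  exact h5 (mem_requiredAt.2 ⟨c, h1, rfl, hct.le, h4, H⟩)

theorem star_of_mem_sdiff (hA : IsOnlineSolution σ k A) {t : ℕ} (ht : t + 1 ≤ σ.horizon)
    {p : Fin n} (hp : p ∈ requiredAt σ A t) (hp' : p ∉ requiredAt σ A (t + 1)) :
    (p, t + 1) ∈ (A (t + 1)).stars := by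
  obtain ⟨r, h1, h2, h3, h4, h5⟩ := mem_requiredAt.1 hp
  obtain ⟨-, -, h6, h7⟩ := hA.le (Nat.le_succ t) ht
  by_contra h
  refine hp' (mem_requiredAt.2 ⟨r, h1, h2, by omega, fun h8 => h4 (h7 r h8 h3), ?_⟩)
  intro τ h8 h9 h10
  rcases (by omega : τ ≤ t ∨ τ = t + 1) with h11 | rfl
  · exact h5 τ h8 h11 (h6 _ h10 h11)
  · exact h h10

/-- Nothing is visited unless there is a critical request. In that case, either there is a free
place, or a page makes room. -/
theorem decisionAt_cases (hA : IsOnlineSolution σ k A) {t : ℕ} (ht : t ≤ σ.horizon) :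
    ((∀ c ∈ outstandingAt k w σ A t, c.deadline ≠ t) ∧ decisionAt k w σ A t = (none, ∅)) ∨
    ∃ c ∈ outstandingAt k w σ A t, c.deadline = t ∧
      (((requiredAt σ A t).card < k ∧ decisionAt k w σ A t = (none, {c.page})) ∨
      ∃ q, CanMakeRoom k (observe σ A t) t c q ∧ decisionAt k w σ A t =
        (some q, insert c.page (batch w (unit w q) (outstandingAt k w σ A t)))) := by
  by_cases h : ∃ c ∈ outstandingAt k w σ A t, c.deadline = t
  · refine Or.inr ⟨h.choose, h.choose_spec.1, h.choose_spec.2, ?_⟩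
    have hd : decisionAt k w σ A t = (slotFor k (observe σ A t) t h.choose, insert h.choose.page
      ((slotFor k (observe σ A t) t h.choose).elim ∅ fun q =>
        batch w (unit w q) (outstandingAt k w σ A t))) := by
      rw [decisionAt, decision, dif_pos h]
    by_cases hq : ∃ q, CanMakeRoom k (observe σ A t) t h.choose q
    · refine Or.inr ⟨hq.choose, hq.choose_spec, ?_⟩
      have hs : slotFor k (observe σ A t) t h.choose = some hq.choose := by
        rw [slotFor, dif_pos hq]
      rw [hd, hs]
      rfl
    · refine Or.inl ⟨?_, ?_⟩
      · by_contra! hc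
        exact hq (exists_canMakeRoom hA ht hc h.choose_spec.1 h.choose_spec.2)
      · have hs : slotFor k (observe σ A t) t h.choose = none := by
          rw [slotFor, dif_neg hq]
        rw [hd, hs]
        rfl
  · refine Or.inl ⟨fun c hc hct => h ⟨c, hc, hct⟩, ?_⟩
    rw [decisionAt, decision, dif_neg h]

theorem exists_request_of_mem_batch {u : ℝ} {O : Finset (Request n)} {p : Fin n}
    (hp : p ∈ batch w u O) : ∃ r ∈ O, r.page = p := by
  obtain ⟨r, hr, h⟩ := Finset.mem_image.1 hp
  exact ⟨r, (Finset.mem_filter.1 hr).1, h⟩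

theorem exists_request_of_visited (hA : IsOnlineSolution σ k A) {t : ℕ} (ht : t ≤ σ.horizon)
    {p : Fin n} (hp : p ∈ (decisionAt k w σ A t).2) :
    ∃ r ∈ outstandingAt k w σ A t, r.page = p := by
  rcases decisionAt_cases (w := w) hA ht with
    ⟨-, h⟩ | ⟨c, hc, -, ⟨-, h⟩ | ⟨q, -, h⟩⟩ <;> rw [h] at hp
  · simp at hp
  · exact ⟨c, hc, (Finset.mem_singleton.1 hp).symm⟩
  · rcases Finset.mem_insert.1 hp with rfl | hp
    · exact ⟨c, hc, rfl⟩
    · exact exists_request_of_mem_batch hp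

/-- The cache before time `t`. -/
theorem stateAt_cache (k : ℕ) (w : Fin n → ℝ) (t : ℕ) :
    (stateAt k w (observe σ A) (t + 1)).cache = requiredAt σ A t := by
  simp [stateAt, AlgState.next, stateAt_time]

theorem run_eq (t : ℕ) : (conversion k w).run σ A t =
    stepOps (stateAt k w (observe σ A) t).cache (requiredAt σ A t) (decisionAt k w σ A t).1
      (decisionAt k w σ A t).2 := by
  rw [run_conversion, AlgState.ops, stateAt_time]

theorem leads_run (hA : IsOnlineSolution σ k A) {t : ℕ} (ht : t ≤ σ.horizon) :
    Leads k (stateAt k w (observe σ A) t).cache ((conversion k w).run σ A t)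
      (requiredAt σ A t) := by
  rw [run_eq]
  refine leads_stepOps ?_ (card_requiredAt_le hA ht) ?_ ?_ ?_
  · cases t with
    | zero => simp [stateAt, AlgState.init]
    | succ t => rw [stateAt_cache]; exact card_requiredAt_le hA (by omega)
  · intro p hp
    obtain ⟨r, hr, rfl⟩ := exists_request_of_visited hA ht hp
    exact (mem_outstandingAt.1 hr).2.2.2.2.1
  · intro q hq
    rcases decisionAt_cases (w := w) hA ht with
      ⟨-, h⟩ | ⟨c, hc, -, ⟨-, h⟩ | ⟨q', hq', h⟩⟩ <;> rw [h] at hq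
    · simp at hq
    · simp at hq
    · obtain rfl : q' = q := by simpa using hq
      exact hq'.2.1
  · intro hV hn
    rcases decisionAt_cases (w := w) hA ht with
      ⟨-, h⟩ | ⟨c, hc, -, ⟨h', h⟩ | ⟨q', hq', h⟩⟩
    · rw [h] at hV
      simp at hV
    · exact h'
    · rw [h] at hn
      simp at hn

theorem cacheAt_run (hA : IsOnlineSolution σ k A) {t : ℕ} (ht : t ≤ σ.horizon + 1) :
    ((conversion k w).run σ A).cacheAt t = (stateAt k w (observe σ A) t).cache := by
  induction t with
  | zero => rfl
  | succ t ih =>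
    rw [Schedule.cacheAt, ih (by omega), stateAt_cache]
    exact (leads_run hA (by omega)).1

theorem valid_run (hA : IsOnlineSolution σ k A) : ((conversion k w).run σ A).Valid σ k := by
  intro t ht c hc
  rw [Schedule.trace, cacheAt_run hA (by omega)] at hc
  exact (leads_run hA ht).2 c hc

theorem serves_run (hA : IsOnlineSolution σ k A) {r : Request n} (hr : r ∈ σ.requests)
    (hp : r ∉ (A σ.horizon).penalized) : ((conversion k w).run σ A).Serves r := by
  have hd := σ.deadline_le_horizon r hr
  have hs := σ.start_le_deadline r hr
  have h1 : ∃ t, r.start ≤ t ∧ t ≤ r.deadline ∧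
      (r.page ∈ requiredAt σ A t ∨ r.page ∈ (decisionAt k w σ A t).2) := by
    by_contra! H
    have hout : r ∈ outstandingAt k w σ A r.deadline :=
      mem_outstandingAt.2 ⟨hr, hs, le_rfl, fun h => hp ((hA.le hd le_rfl).2.1 h),
        (H _ hs le_rfl).1, fun t' h1 h2 => H t' h1 h2.le⟩
    have hno := (H _ hs le_rfl).2
    rcases decisionAt_cases (w := w) hA hd with ⟨h, -⟩ | ⟨c, hc, hct, h⟩
    · exact h r hout rfl
    · obtain rfl : c = r := σ.deadline_injOn (mem_outstandingAt.1 hc).1 hr hct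
      rcases h with ⟨-, h⟩ | ⟨q, -, h⟩ <;> rw [h] at hno <;> simp at hno
  obtain ⟨t, h2, h3, h4⟩ := h1
  refine ⟨t, h2, h3, ?_⟩
  rcases h4 with h4 | h4
  · refine ⟨_, Schedule.cacheAt_succ_mem_trace _ t, ?_⟩
    rw [cacheAt_run hA (by omega), stateAt_cache]
    exact h4
  · rw [Schedule.trace, cacheAt_run hA (by omega), run_eq]
    exact mem_scanl_stepOps _ _ _ h4

/-! ### The cost of the algorithm -/

/-- At time `t`, the page `p` has an outstanding request that has already had its star. As soon as
`p` is visited at such a time, no later request of `p` is hit by this star and still waiting. -/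
def Paid (k : ℕ) (w : Fin n → ℝ) (σ : Instance n) (A : ℕ → IPSolution n) (t : ℕ) (p : Fin n) :
    Prop :=
  ∃ r ∈ outstandingAt k w σ A t, r.page = p ∧
    ∃ τ, r.start ≤ τ ∧ τ ≤ t ∧ (p, τ) ∈ (A σ.horizon).stars

open Classical in
theorem sum_paid_le (hw : ∀ p, 0 ≤ w p) :
    ∑ t ∈ Finset.range (σ.horizon + 1),
        ∑ p ∈ (decisionAt k w σ A t).2 with Paid k w σ A t p, w p
      ≤ ∑ a ∈ (A σ.horizon).stars, w a.1 := by
  rw [Finset.sum_sigma']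
  have h : ∀ x : (_ : ℕ) × Fin n, ∃ τ, Paid k w σ A x.1 x.2 →
      ∃ r ∈ outstandingAt k w σ A x.1, r.page = x.2 ∧ r.start ≤ τ ∧ τ ≤ x.1 ∧
        (x.2, τ) ∈ (A σ.horizon).stars := by
    intro x
    by_cases hx : Paid k w σ A x.1 x.2
    · obtain ⟨r, h1, h2, τ, h3⟩ := hx
      exact ⟨τ, fun _ => ⟨r, h1, h2, h3⟩⟩
    · exact ⟨0, fun h => absurd h hx⟩
  choose τ hτ using h
  refine sum_le_sum_stars hw (fun x => (x.2, τ x)) ?_ ?_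
  · intro x hx
    simp only [Finset.mem_sigma, Finset.mem_filter] at hx
    obtain ⟨r, -, -, -, -, h⟩ := hτ x hx.2.2
    exact h
  · have key : ∀ t₁ t₂ : ℕ, ∀ p, t₁ < t₂ → p ∈ (decisionAt k w σ A t₁).2 →
        Paid k w σ A t₁ p → Paid k w σ A t₂ p → τ ⟨t₁, p⟩ ≠ τ ⟨t₂, p⟩ := by
      intro t₁ t₂ p hlt hp h1 h2 he
      obtain ⟨r₁, -, -, -, h4, -⟩ := hτ ⟨t₁, p⟩ h1
      obtain ⟨r₂, h5, h6, h7, -, -⟩ := hτ ⟨t₂, p⟩ h2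
      have h8 := (mem_outstandingAt.1 h5).2.2.2.2.2 t₁ (by dsimp only at *; omega) hlt
      rw [h6] at h8
      exact h8.2 hp
    rintro ⟨t₁, p₁⟩ h1 ⟨t₂, p₂⟩ h2 he
    simp only [Finset.coe_sigma, Set.mem_sigma_iff, Finset.mem_coe, Finset.mem_filter] at h1 h2
    obtain ⟨rfl, he⟩ := Prod.mk.inj he
    rcases lt_trichotomy t₁ t₂ with h | rfl | h
    · exact absurd he (key t₁ t₂ _ h h1.2.1 h1.2.2 h2.2.2)
    · rfl
    · exact absurd he.symm (key t₂ t₁ _ h h2.2.1 h2.2.2 h1.2.2)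

theorem sum_removed_le (hw : ∀ p, 0 ≤ w p) (hA : IsOnlineSolution σ k A) :
    ∑ t ∈ Finset.range (σ.horizon + 1),
        ∑ p ∈ (stateAt k w (observe σ A) t).cache \ requiredAt σ A t, w p
      ≤ ∑ a ∈ (A σ.horizon).stars, w a.1 := by
  rw [Finset.sum_sigma']
  refine sum_le_sum_stars hw (fun x : (_ : ℕ) × Fin n => (x.2, x.1)) ?_ ?_
  · rintro ⟨t, p⟩ hx
    simp only [Finset.mem_sigma, Finset.mem_range, Finset.mem_sdiff] at hx
    cases t with
    | zero => simp [stateAt, AlgState.init] at hx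
    | succ t =>
      rw [stateAt_cache] at hx
      exact (hA.le (by omega) le_rfl).1 (star_of_mem_sdiff hA (by omega) hx.2.1 hx.2.2)
  · rintro ⟨t₁, p₁⟩ - ⟨t₂, p₂⟩ - he
    obtain ⟨rfl, rfl⟩ := Prod.mk.inj he
    rfl

/-- The cost of the operations for the outstanding requests at time `t`. -/
noncomputable def serviceCost (k : ℕ) (w : Fin n → ℝ) (σ : Instance n) (A : ℕ → IPSolution n)
    (t : ℕ) : ℝ :=
  (decisionAt k w σ A t).1.elim 0 w + ∑ p ∈ (decisionAt k w σ A t).2, w p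

open Classical in
theorem serviceCost_le_of_none (hA : IsOnlineSolution σ k A) {t : ℕ}
    (ht : t ≤ σ.horizon) (hn : (decisionAt k w σ A t).1 = none) :
    serviceCost k w σ A t ≤ ∑ p ∈ (decisionAt k w σ A t).2 with Paid k w σ A t p, w p := by
  rcases decisionAt_cases (w := w) hA ht with
    ⟨-, h⟩ | ⟨c, hc, hct, ⟨-, h⟩ | ⟨q, -, h⟩⟩
  · simp [serviceCost, h]
  · obtain ⟨τ, h1, h2, h3⟩ := exists_star_of_critical hc hct
    have hp : Paid k w σ A t c.page := ⟨c, hc, rfl, τ, h1, h2, (hA.le ht le_rfl).1 h3⟩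
    simp [serviceCost, h, Finset.filter_singleton, hp]
  · rw [h] at hn
    simp at hn

open Classical in
theorem sum_serviceCost_le (hw : ∀ p, 0 ≤ w p) (hA : IsOnlineSolution σ k A) :
    ∑ t ∈ Finset.range (σ.horizon + 1), serviceCost k w σ A t
      ≤ (4 + 5 * (3 + 2 * (Nat.log 2 n + 3 : ℕ))) * ∑ a ∈ (A σ.horizon).stars, w a.1 := by
  set X := (A σ.horizon).stars with hX
  rcases isEmpty_or_nonempty (Fin n) with hn | hn
  · have h1 : ∀ t, serviceCost k w σ A t = 0 := by
      intro t
      have h2 : (decisionAt k w σ A t).1 = none := by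
        cases h : (decisionAt k w σ A t).1 with
        | none => rfl
        | some q => exact hn.elim q
      rw [serviceCost, h2, Finset.sum_eq_zero fun p _ => hn.elim p]
      simp
    rw [Finset.sum_eq_zero fun t _ => h1 t, Finset.sum_eq_zero fun a _ => hn.elim a.1]
    simp
  -- the times at which a page makes room
  set T := (Finset.range (σ.horizon + 1)).filter fun t => (decisionAt k w σ A t).1 ≠ none with hT
  have hdata : ∀ t, ∃ (q : Fin n) (c : Request n) (τ : ℕ), t ∈ T →
      c ∈ outstandingAt k w σ A t ∧ c.deadline = t ∧ k ≤ (requiredAt σ A t).card ∧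
      (q, τ) ∈ X ∧ c.start ≤ τ ∧ τ ≤ t ∧ decisionAt k w σ A t =
        (some q, insert c.page (batch w (unit w q) (outstandingAt k w σ A t))) := by
    intro t
    by_cases ht : t ∈ T
    · obtain ⟨ht1, ht2⟩ := Finset.mem_filter.1 ht
      have htH : t ≤ σ.horizon := by simpa [Nat.lt_succ_iff] using ht1
      rcases decisionAt_cases (w := w) hA htH with
        ⟨-, h⟩ | ⟨c, hc, hct, ⟨-, h⟩ | ⟨q, ⟨h1, h2, τ, h3, h4, h5⟩, h⟩⟩
      · exact absurd (congrArg Prod.fst h) ht2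
      · exact absurd (congrArg Prod.fst h) ht2
      · refine ⟨q, c, τ, fun _ => ⟨hc, hct, h1, ?_, h3, h4, h⟩⟩
        simp only [observe, Finset.mem_filter] at h5
        exact (hA.le htH le_rfl).1 h5.1
    · exact ⟨Classical.arbitrary _, ⟨Classical.arbitrary _, 0, 0, 0⟩, 0, fun h => absurd h ht⟩
  choose q c τ hd using hdata
  have hTH : ∀ t ∈ T, t ≤ σ.horizon := fun t ht => by
    simpa [Nat.lt_succ_iff] using (Finset.mem_filter.1 ht).1
  set P : ℕ → ℝ := fun t => ∑ p ∈ (decisionAt k w σ A t).2 with Paid k w σ A t p, w p with hP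
  have hP0 : ∀ t, 0 ≤ P t := fun t => Finset.sum_nonneg fun _ _ => hw _
  have hPsum : ∑ t ∈ Finset.range (σ.horizon + 1), P t ≤ ∑ a ∈ X, w a.1 := sum_paid_le hw
  have hunits := sum_unit_le hw X T q (fun t => (c t).page) (fun t => (c t).start) τ
    (fun t => (decisionAt k w σ A t).2) (Paid k w σ A) ?_ ?_ ?_
  · have hstep : ∀ t ∈ Finset.range (σ.horizon + 1), serviceCost k w σ A t ≤ 4 * P t +
        5 * if t ∈ T ∧ w (c t).page < 2 * unit w (q t) then unit w (q t) else 0 := by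
      intro t ht
      have htH : t ≤ σ.horizon := by simpa [Nat.lt_succ_iff] using ht
      by_cases htT : t ∈ T
      · obtain ⟨h1, h2, h3, h4, h5, h6, h7⟩ := hd t htT
        obtain ⟨τ', h8, h9, h10⟩ := exists_star_of_critical h1 h2
        have hpaid : w (c t).page ≤ P t := by
          refine Finset.single_le_sum (f := w) (fun _ _ => hw _) ?_
          rw [Finset.mem_filter, h7]
          exact ⟨Finset.mem_insert_self _ _, c t, h1, rfl, τ', h8, h9, (hA.le htH le_rfl).1 h10⟩
        have hbatch : ∑ p ∈ batch w (unit w (q t)) (outstandingAt k w σ A t), w p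
            ≤ 3 * unit w (q t) := by
          refine sum_batch_le hw (unit_nonneg _ _) (σ.deadline_injOn.mono fun r hr => ?_)
          exact (mem_outstandingAt.1 hr).1
        have hcost : serviceCost k w σ A t ≤ 5 * unit w (q t) + w (c t).page := by
          rw [serviceCost, h7]
          have h11 : ∑ p ∈ insert (c t).page
              (batch w (unit w (q t)) (outstandingAt k w σ A t)), w p
              ≤ w (c t).page + ∑ p ∈ batch w (unit w (q t)) (outstandingAt k w σ A t), w p := by
            by_cases h : (c t).page ∈ batch w (unit w (q t)) (outstandingAt k w σ A t)
            · rw [Finset.insert_eq_of_mem h]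
              linarith [hw (c t).page]
            · rw [Finset.sum_insert h]
          have := le_two_mul_unit w (q t)
          simp only [Option.elim]
          linarith
        have := hP0 t
        by_cases hl : w (c t).page < 2 * unit w (q t)
        · rw [if_pos ⟨htT, hl⟩]
          linarith
        · rw [if_neg fun h => hl h.2]
          linarith
      · have hnone : (decisionAt k w σ A t).1 = none := by
          by_contra h
          exact htT (Finset.mem_filter.2 ⟨ht, h⟩)
        rw [if_neg fun h => htT h.1]
        have h1 := serviceCost_le_of_none hA htH hnone
        have := hP0 t
        simp only [hP] at this ⊢
        linarith
    have h1 := Finset.sum_le_sum hstep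
    rw [Finset.sum_add_distrib, ← Finset.mul_sum, ← Finset.mul_sum, ← Finset.sum_filter] at h1
    have h2 : (Finset.range (σ.horizon + 1)).filter
        (fun t => t ∈ T ∧ w (c t).page < 2 * unit w (q t))
        = T.filter fun t => w (c t).page < 2 * unit w (q t) := by
      ext t
      simp only [Finset.mem_filter, hT]
      tauto
    rw [h2] at h1
    linarith
  · intro t ht
    obtain ⟨-, -, -, h4, h5, h6, -⟩ := hd t ht
    exact ⟨h4, h5, h6⟩
  · exact (Finset.sum_le_sum_of_subset_of_nonneg (Finset.filter_subset _ _)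
      fun t _ _ => hP0 t).trans hPsum
  · intro t₁ ht₁ t₂ ht₂ hlt hs hu hlight
    obtain ⟨-, -, hfull, -, -, -, hdec⟩ := hd t₁ ht₁
    obtain ⟨h1, h2, -, -, -, -, -⟩ := hd t₂ ht₂
    obtain ⟨h3, h4, h5, h6, h7, h8⟩ := mem_outstandingAt.1 h1
    have h9 := h8 t₁ hs hlt
    -- the request that is critical at time `t₂` was passed over at time `t₁`
    have hout : c t₂ ∈ outstandingAt k w σ A t₁ := mem_outstandingAt.2
      ⟨h3, hs, by omega, fun h => h6 ((hA.le hlt.le (hTH _ ht₂)).2.1 h), h9.1,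
        fun t' h10 h11 => h8 t' h10 (by omega)⟩
    have hsub : batch w (unit w (q t₁)) (outstandingAt k w σ A t₁)
        ⊆ (decisionAt k w σ A t₁).2 := by
      rw [hdec]
      exact Finset.subset_insert _ _
    rw [← hu] at hlight ⊢
    obtain ⟨Q, hQ, hQu, hQr⟩ := exists_subset_batch hout hlight fun h => h9.2 (hsub h)
    refine ⟨Q, hQ.trans hsub, hQu, fun x hx => ?_⟩
    obtain ⟨r, hr, rfl, hrl, hrd⟩ := hQr x hx
    obtain ⟨τ', h10, h11, h12⟩ := exists_star_of_full hA (hTH _ ht₁) hfull hr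
    have h13 := (hA.le (hTH _ ht₁) le_rfl).1 h12
    refine ⟨hrl, ?_⟩
    by_cases h : τ' ≤ t₁
    · exact Or.inl ⟨r, hr, rfl, τ', h10, h, h13⟩
    · exact Or.inr ⟨τ', by omega, by omega, h13⟩

theorem natLog_two_le (n : ℕ) : (Nat.log 2 n : ℝ) ≤ 2 * Real.log n := by
  rcases Nat.eq_zero_or_pos n with rfl | hn
  · simp
  have h1 : ((2 : ℝ) ^ Nat.log 2 n) ≤ n := by
    exact_mod_cast Nat.pow_log_le_self 2 hn.ne'
  have h2 := Real.log_le_log (by positivity) h1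
  rw [Real.log_pow] at h2
  have h3 := Real.log_two_gt_d9
  have h4 : (0 : ℝ) ≤ Nat.log 2 n := Nat.cast_nonneg _
  nlinarith

theorem evictionCost_run_le (w : Fin n → ℝ≥0) (hA : IsOnlineSolution σ k A) :
    ((conversion k fun p => (w p : ℝ)).run σ A).evictionCost σ w
      ≤ 50 * ENNReal.ofReal (1 + Real.log n) * ∑ a ∈ (A σ.horizon).stars, (w a.1 : ℝ≥0∞) := by
  set v : Fin n → ℝ := fun p => (w p : ℝ) with hv
  have hw : ∀ p, 0 ≤ v p := fun p => NNReal.coe_nonneg _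
  have h1 : ∀ t, (((conversion k v).run σ A t).map (Op.cost w)).sum = ENNReal.ofReal
      (∑ p ∈ (stateAt k v (observe σ A) t).cache \ requiredAt σ A t, v p
        + serviceCost k v σ A t) := by
    intro t
    rw [run_eq, cost_stepOps, serviceCost, add_assoc]
  have hlog : 0 ≤ Real.log n := Real.log_natCast_nonneg n
  have hsc : ∀ t, 0 ≤ serviceCost k v σ A t := fun t => by
    refine add_nonneg ?_ (Finset.sum_nonneg fun _ _ => hw _)
    cases (decisionAt k v σ A t).1 with
    | none => exact le_rfl
    | some q => exact hw q
  unfold Schedule.evictionCost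
  simp only [h1]
  rw [← ENNReal.ofReal_sum_of_nonneg fun t _ =>
    add_nonneg (Finset.sum_nonneg fun _ _ => hw _) (hsc t)]
  have h2 : ∑ a ∈ (A σ.horizon).stars, (w a.1 : ℝ≥0∞)
      = ENNReal.ofReal (∑ a ∈ (A σ.horizon).stars, v a.1) := by
    rw [ENNReal.ofReal_sum_of_nonneg fun _ _ => hw _]
    simp [hv]
  have h3 : (50 : ℝ≥0∞) = ENNReal.ofReal 50 := by simp
  rw [h2, h3, ← ENNReal.ofReal_mul (by norm_num), ← ENNReal.ofReal_mul (by positivity)]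
  refine ENNReal.ofReal_le_ofReal ?_
  rw [Finset.sum_add_distrib]
  have h4 := sum_removed_le hw hA
  have h5 := sum_serviceCost_le hw hA
  have h6 := natLog_two_le n
  have h7 : 0 ≤ ∑ a ∈ (A σ.horizon).stars, v a.1 := Finset.sum_nonneg fun _ _ => hw _
  push_cast at h5
  have h8 := mul_le_mul_of_nonneg_right h6 h7
  have h9 := mul_nonneg hlog h7
  linarith

theorem cost_run_le (w : Fin n → ℝ≥0) (hA : IsOnlineSolution σ k A) :
    ((conversion k fun p => (w p : ℝ)).run σ A).cost σ w
      ≤ 50 * ENNReal.ofReal (1 + Real.log n) * (A σ.horizon).cost w := by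
  classical
  have h1 : (1 : ℝ≥0∞) ≤ 50 * ENNReal.ofReal (1 + Real.log n) := by
    refine one_le_mul (by norm_num) ?_
    rw [ENNReal.one_le_ofReal]
    linarith [Real.log_natCast_nonneg n]
  unfold Schedule.cost IPSolution.cost
  rw [mul_add]
  refine add_le_add (evictionCost_run_le w hA) (le_trans ?_ (le_mul_of_one_le_left' h1))
  refine Finset.sum_le_sum_of_subset fun r hr => ?_
  obtain ⟨hr, hns⟩ := Finset.mem_filter.1 hr
  by_contra h
  exact hns (serves_run hA hr h)

/-- Competitiveness against solutions of the program gives competitiveness against schedules. -/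
theorem mul_le_of_competitive {x L c d s : ℝ≥0∞} {α b : ℝ≥0} (hx : x ≤ 50 * L * c)
    (hc : c ≤ α * d + b) (hd : d ≤ 2 * s) : x ≤ ((100 : ℝ≥0) : ℝ≥0∞) * L * (α * s + b) := by
  calc x ≤ 50 * L * c := hx
    _ ≤ 50 * L * (α * (2 * s) + 2 * b) := by
        gcongr
        refine hc.trans (add_le_add (by gcongr) (le_mul_of_one_le_left' one_le_two))
    _ = (50 * 2) * L * (α * s + b) := by ring
    _ = ((100 : ℝ≥0) : ℝ≥0∞) * L * (α * s + b) := by norm_num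

end PagingTW

/-- There is an absolute constant `C` and, for all parameters, an online algorithm that turns every
online integral solution of the hitting set program into a cache schedule, with a loss of
`C * (1 + log n)`. The first part is for paging with time windows and penalties, the second for
paging with time windows, where all requests have to be served. -/
theorem theorem3 :
    ∃ C : ℝ≥0, ∀ (n k : ℕ) (w : Fin n → ℝ≥0), ∃ alg : PagingTW.OnlineAlgorithm n,
      ∀ (σ : PagingTW.Instance n) (A : ℕ → PagingTW.IPSolution n),
        PagingTW.IsOnlineSolution σ k A →
        ((alg.run σ A).Valid σ k ∧
          (∀ r ∈ σ.requests, r ∉ (A σ.horizon).penalized → (alg.run σ A).Serves r) ∧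
          (alg.run σ A).cost σ w
            ≤ C * ENNReal.ofReal (1 + Real.log n) * (A σ.horizon).cost w ∧
          ∀ α b : ℝ≥0, PagingTW.IPCompetitive σ k w A α b →
            ∀ S : PagingTW.Schedule n, S.Valid σ k →
              (alg.run σ A).cost σ w
                ≤ C * ENNReal.ofReal (1 + Real.log n) * (α * (S.cost σ w + ∑ p, w p) + b)) ∧
        ((∀ t ≤ σ.horizon, (A t).penalized = ∅) →
          (∀ r ∈ σ.requests, (alg.run σ A).Serves r) ∧
          (alg.run σ A).evictionCost σ w
            ≤ C * ENNReal.ofReal (1 + Real.log n) * (A σ.horizon).cost w ∧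
          ∀ α b : ℝ≥0, PagingTW.IPCompetitiveNoPenalty σ k w A α b →
            ∀ S : PagingTW.Schedule n, S.Valid σ k → (∀ r ∈ σ.requests, S.Serves r) →
              (alg.run σ A).evictionCost σ w
                ≤ C * ENNReal.ofReal (1 + Real.log n)
                  * (α * (S.evictionCost σ w + ∑ p, w p) + b)) := by
  refine ⟨100, fun n k w => ⟨PagingTW.conversion k fun p => (w p : ℝ), fun σ A hA => ?_⟩⟩
  have hmono : ∀ L x : ℝ≥0∞, 50 * L * x ≤ ((100 : ℝ≥0) : ℝ≥0∞) * L * x := fun L x => by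
    gcongr
    norm_num
  refine ⟨⟨PagingTW.valid_run hA, fun r hr hp => PagingTW.serves_run hA hr hp,
    (PagingTW.cost_run_le w hA).trans (hmono _ _), fun α b hcomp S hS => ?_⟩, fun hy => ?_⟩
  · have := PagingTW.mul_le_of_competitive (PagingTW.cost_run_le w hA)
      (hcomp _ (S.toIP_feasible σ k hS)) (S.toIP_cost_le σ w)
    push_cast at this ⊢
    exact this
  · have hpen := hy σ.horizon le_rfl
    have hcost : (A σ.horizon).cost w = ∑ a ∈ (A σ.horizon).stars, (w a.1 : ℝ≥0∞) := by
      simp [PagingTW.IPSolution.cost, hpen]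
    have hev := PagingTW.evictionCost_run_le w hA
    rw [← hcost] at hev
    refine ⟨fun r hr => PagingTW.serves_run hA hr (by simp [hpen]), hev.trans (hmono _ _),
      fun α b hcomp S hS hserve => ?_⟩
    have hSpen : (S.toIP σ).penalized = ∅ := by
      simpa [PagingTW.Schedule.toIP, Finset.filter_eq_empty_iff] using hserve
    have hScost : (S.toIP σ).cost w ≤ 2 * (S.evictionCost σ w + ∑ p, (w p : ℝ≥0∞)) := by
      rw [PagingTW.IPSolution.cost, hSpen, Finset.sum_empty, add_zero, mul_add]
      refine (S.sum_stars_toIP_le σ w).trans (add_le_add le_rfl ?_)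
      exact le_mul_of_one_le_left' one_le_two
    have := PagingTW.mul_le_of_competitive hev (hcomp _ hSpen (S.toIP_feasible σ k hS)) hScost
    push_cast at this ⊢
    exact this
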